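/- Let $q\ge 3$ be an integer and $p\in(0,1)$. Let $\mathcal T_q$ be the homogeneous tree of degree $q$, viewed as the Cayley graph of the free product $\mathbb Z/2*\cdots*\mathbb Z/2$ of $q$ factors with canonical generators $a_1,\dots,a_q$ and identity $o$, and let $|x|$ be the tree distance of $x$ to $o$. Let $\mathcal L_q=(\mathbb Z/2)\wr\mathcal T_q$ be the wreath product: its elements are the pairs $(\eta,x)$ with $\eta:\mathcal T_q\to\mathbb Z/2$ finitely supported and $x\in\mathcal T_q$, with product $(\eta_1,x)(\eta_2,y)=(\eta_1\oplus x\eta_2,\,xy)$, where $(x\eta)(w)=\eta(x^{-1}w)$. Let $\ell((\eta,x))$ be the graph distance from $(\eta,x)$ to $(\mathbf 0,o)$ in the Cayley graph of $\mathcal L_q$ with respect to the generators $(\mathbf 1_o,o)$, $(\mathbf 0,a_1),\dots,(\mathbf 0,a_q)$. Let $Z_0=(\mathbf 0,o)$ and $Z_n=Z_{n-1}\mathbf i_n$ for $n\ge 1$, where $\mathbf i_1,\mathbf i_2,\dots$ are independent random elements of $\mathcal L_q$, each equal to $(\mathbf 1_o,o)$ with probability $p$ and to $(\mathbf 0,a_i)$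 with probability $(1-p)/q$ for $i=1,\dots,q$. Write $Z_n=(\eta_n,X_n)$. Then there is a constant $\ell$ (the rate of escape) with $\ell(Z_n)/n\to\ell$ almost surely, $|X_n|/n\to\frac{(1-p)(q-2)}{q}$ almost surely, and the following bounds hold: $$\ell\ \ge\ \ell_{\mathrm{low}}:=\frac{(1-p)(q-2)}{q}\cdot\frac{q-2+2p(q+1)}{pq+q-2},$$ $$\ell\ \le\ \ell_{\mathrm{up}}(G):=\frac{(1-p)(q-2)}{q}\Bigl(\frac{q+1}{q-1}-\frac{2q}{q-1}\,\widehat\nu_2(G)+\frac{pq}{pq+q-2}\Bigr),\qquad \widehat\nu_2(G):=\frac{G}{1-G^2p^2}\cdot\frac{(1-p)(q-2)}{q(q-1)},$$ where the upper bound holds both for $$G=\widehat G:=\frac{2(q-1)}{q-2+\sqrt{q^2-4(q-1)(1-p)^2}}$$ and for $$G=\frac1{1-\widehat U},\qquad \widehat U:=\frac{q-1}{q}(1-p)\bar F+\frac{1-p}{q}\cdot\frac1{q-1},\qquad \bar F:=\frac{q-\sqrt{q^2-4(q-1)(1-p)^2}}{2(q-1)(1-p)}.$$ Moreover $\ell>\frac{(1-p)(q-2)}{q}$,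 that is, the walk escapes strictly faster than its projection onto the tree. -/

import Mathlib

open MeasureTheory ProbabilityTheory Filter Topology

noncomputable section

namespace LamplighterTree

/-- The free product of `q` copies of `ℤ/2`, whose Cayley graph with respect to the `q` canonical
generators is the homogeneous tree of degree `q`. Its elements are the vertices of the tree. -/
abbrev Tree (q : ℕ) : Type := Monoid.CoprodI (fun _ : Fin q => Multiplicative (ZMod 2))

/-- The generator (letter) `a_i` of the free product, an involution. -/
def letter {q : ℕ} (i : Fin q) : Tree q :=
  Monoid.CoprodI.of (M := fun _ : Fin q => Multiplicative (ZMod 2)) (i := i)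
    (Multiplicative.ofAdd (1 : ZMod 2))

/-- The tree distance `|x|` of the vertex `x` to the root `o`, which is the identity. -/
def treeDist {q : ℕ} (x : Tree q) : ℕ :=
  (SimpleGraph.mulCayley (Set.range (letter (q := q)))).dist x 1

/-- Elements `(η, x)` of the wreath product `(ℤ/2) ≀ Tree q`: a finitely supported lamp
configuration `η` together with the position `x` of the lamplighter. -/
@[ext]
structure Lamplighter (q : ℕ) where
  /-- the lamp configuration -/
  lamps : Tree q →₀ ZMod 2
  /-- the position of the lamplighter -/
  pos : Tree q

/-- The translate `xη`, which is `w ↦ η (x⁻¹ w)`. -/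
def shift {q : ℕ} (x : Tree q) (η : Tree q →₀ ZMod 2) : Tree q →₀ ZMod 2 :=
  Finsupp.equivMapDomain (Equiv.mulLeft x) η

theorem shift_apply {q : ℕ} (x : Tree q) (η : Tree q →₀ ZMod 2) (w : Tree q) :
    shift x η w = η (x⁻¹ * w) := rfl

namespace Lamplighter

variable {q : ℕ}

/-- `(η₁, x) (η₂, y) = (η₁ ⊕ xη₂, xy)`. -/
instance : Mul (Lamplighter q) := ⟨fun g h => ⟨g.lamps + shift g.pos h.lamps, g.pos * h.pos⟩⟩

instance : One (Lamplighter q) := ⟨⟨0, 1⟩⟩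

instance : Inv (Lamplighter q) := ⟨fun g => ⟨shift g.pos⁻¹ g.lamps, g.pos⁻¹⟩⟩

theorem mul_lamps (g h : Lamplighter q) : (g * h).lamps = g.lamps + shift g.pos h.lamps := rfl

theorem mul_pos (g h : Lamplighter q) : (g * h).pos = g.pos * h.pos := rfl

theorem one_lamps : (1 : Lamplighter q).lamps = 0 := rfl

theorem one_pos : (1 : Lamplighter q).pos = 1 := rfl

theorem inv_lamps (g : Lamplighter q) : (g⁻¹).lamps = shift g.pos⁻¹ g.lamps := rfl

theorem inv_pos (g : Lamplighter q) : (g⁻¹).pos = g.pos⁻¹ := rfl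

instance : Group (Lamplighter q) :=
  Group.ofLeftAxioms
    (by
      intro g h k
      ext w
      · simp only [mul_lamps, mul_pos, Finsupp.add_apply, shift_apply, mul_inv_rev, mul_assoc,
          add_assoc]
      · simp only [mul_pos, mul_assoc])
    (by
      intro g
      ext w
      · simp only [mul_lamps, one_lamps, one_pos, Finsupp.add_apply, shift_apply,
          Finsupp.coe_zero, Pi.zero_apply, zero_add, inv_one, one_mul]
      · simp only [mul_pos, one_pos, one_mul])
    (by
      intro g
      ext w
      · simp only [mul_lamps, inv_lamps, inv_pos, one_lamps, Finsupp.add_apply, shift_apply,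
          Finsupp.coe_zero, Pi.zero_apply]
        exact CharTwo.add_self_eq_zero _
      · simp only [mul_pos, inv_pos, one_pos, inv_mul_cancel])

/-- The discrete σ-algebra. -/
instance : MeasurableSpace (Lamplighter q) := ⊤

instance : DiscreteMeasurableSpace (Lamplighter q) := ⟨fun _ => trivial⟩

/-- The generator `(𝟙_o, o)`: switch the lamp at the actual position. -/
def switch : Lamplighter q := ⟨Finsupp.single 1 1, 1⟩

/-- The generator `(𝟎, a_i)`: move along the letter `a_i`. -/
def move (i : Fin q) : Lamplighter q := ⟨0, letter i⟩

/-- The length `ℓ((η, x))`: the graph distance from `(η, x)` to `(𝟎, o)` in the Cayley graph with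
respect to the generators `switch` and `move i`. -/
def length (z : Lamplighter q) : ℕ :=
  (SimpleGraph.mulCayley (insert (switch (q := q)) (Set.range (move (q := q))))).dist z 1

/-- The law of one increment: `switch` has mass `p` and every `move i` has mass `(1 - p) / q`. -/
def stepLaw (q : ℕ) (p : ℝ) : Measure (Lamplighter q) :=
  ENNReal.ofReal p • Measure.dirac switch +
    ∑ i : Fin q, ENNReal.ofReal ((1 - p) / q) • Measure.dirac (move i)

/-- The random walk with `Z_0 = (𝟎, o)` and `Z_{n+1} = Z_n ξ_n`. -/
def walk {Ω : Type*} (ξ : ℕ → Ω → Lamplighter q) : ℕ → Ω → Lamplighter q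
  | 0, _ => 1
  | n + 1, ω => walk ξ n ω * ξ n ω

end Lamplighter

/-- The speed `(1-p)(q-2)/q` of the projection onto the tree. -/
def treeSpeed (q : ℕ) (p : ℝ) : ℝ := (1 - p) * (q - 2) / q

/-- The lower bound `ℓ_low`. -/
def ellLow (q : ℕ) (p : ℝ) : ℝ :=
  (1 - p) * (q - 2) / q * ((q - 2 + 2 * p * (q + 1)) / (p * q + q - 2))

/-- `Ĝ` in the closed form `2(q-1) / (q-2+√(q²-4(q-1)(1-p)²))`. -/
def greenHat (q : ℕ) (p : ℝ) : ℝ :=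
  2 * (q - 1) / (q - 2 + √((q : ℝ) ^ 2 - 4 * (q - 1) * (1 - p) ^ 2))

/-- The probability `F̄` to reach a given neighbour without changing any lamps, in closed form. -/
def hitBar (q : ℕ) (p : ℝ) : ℝ :=
  (q - √((q : ℝ) ^ 2 - 4 * (q - 1) * (1 - p) ^ 2)) / (2 * (q - 1) * (1 - p))

/-- `1 / (1 - Û)` with `Û = ((q-1)/q)(1-p) F̄ + ((1-p)/q) F` and `F = 1/(q-1)`. -/
def greenHatSharp (q : ℕ) (p : ℝ) : ℝ :=
  1 / (1 - ((q - 1) / q * (1 - p) * hitBar q p + (1 - p) / q * (1 / (q - 1))))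

/-- The lower bound `ν̂₂ = G / (1 - G²p²) · (1-p)(q-2) / (q(q-1))` as a function of `G`. -/
def nuHat (q : ℕ) (p G : ℝ) : ℝ :=
  G / (1 - G ^ 2 * p ^ 2) * ((1 - p) * (q - 2) / (q * (q - 1)))

/-- The expression `(1-p)(q-2)/q · ((q+1)/(q-1) - 2q/(q-1) · ν + pq/(pq+q-2))`. -/
def ellOfNu (q : ℕ) (p ν : ℝ) : ℝ :=
  (1 - p) * (q - 2) / q *
    ((q + 1) / (q - 1) - 2 * q / (q - 1) * ν + p * q / (p * q + q - 2))

end LamplighterTree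

end

/-! The proof computes the drift of the expected length. The length of `(η, x)` is that of a
shortest tour: the number of lit lamps, plus `|x|`, plus twice the number of edges that lead to lit
lamps off the geodesic to `x` (`length_eq_tour`). As the increments are i.i.d., a further increment
may be inserted in front of `Z_n` instead of behind it (`mean_succ_left`). Left multiplication by a
generator moves the start of the tour, so the change of length is decided at the root: it is `±1`
according to the lamp at the root, or to whether one side of an edge at the root is dark
(`tour_switch_mul_eq`, `tour_move_mul_eq`, `mean_tour_succ_sub`).

The expectations that occur are found with functions that are harmonic up to point charges at the
root or at a neighbour, built from `F = 1/(q-1)`, the probability to hit a given neighbour. Every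
error is controlled by `E F^|X_n|`, which tends to `0` (`tendsto_mean_hitRoot`). The sign of the
lamp at the root has limit `1 - lit`. Time reversal gives `P(leaveIn) ≈ (1 - F) + F P(leaveOut)`
(`abs_mean_leave_sub_le`). So only `P(leaveOut)` stays unknown, and the drift is decreasing in it.

The events `leaveOut i` are disjoint for different `i` and force the lamp at the root to be off.
This bounds their total probability from above and gives `ℓ_low`. For the upper bound on `ℓ`,
`P(leaveOut i)` is bounded from below by counting visits to the root by the walk that, outside the
branch at `a_i`, switches no lamp except the one at the root (`le_mean_leaveOut`). This is the bound
with `G = 1/(1 - Û)`; the one with `Ĝ ≤ 1/(1 - Û)` is weaker.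

Almost sure convergence is a subadditive ergodic theorem for i.i.d. increments
(`ae_tendsto_pathProd_div`). The upper rate comes from the strong law for blocks, the lower rate
from a zero-one law and a covering argument. -/

namespace LamplighterTree

/-! ### Word lengths for generating involutions. -/

/-- `f` satisfies the recursive characterisation of the word length of a group with respect to a
set `S` of generating involutions. -/
structure IsWordLength {G : Type*} [Group G] (S : Set G) (f : G → ℕ) : Prop where
  involutive : ∀ s ∈ S, s * s = 1
  one : f 1 = 0
  le_succ : ∀ s ∈ S, ∀ g, f g ≤ f (s * g) + 1
  descent : ∀ g, g ≠ 1 → ∃ s ∈ S, f (s * g) + 1 = f g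

namespace IsWordLength

variable {G : Type*} [Group G] {S : Set G} {f : G → ℕ}

theorem mul_cancel_left (hf : IsWordLength S f) {s : G} (hs : s ∈ S) (g : G) :
    s * (s * g) = g := by
  rw [← mul_assoc, hf.involutive s hs, one_mul]

theorem inv_eq (hf : IsWordLength S f) {s : G} (hs : s ∈ S) : s⁻¹ = s :=
  inv_eq_of_mul_eq_one_left (hf.involutive s hs)

theorem mul_le_succ (hf : IsWordLength S f) {s : G} (hs : s ∈ S) (g : G) :
    f (s * g) ≤ f g + 1 := by
  have := hf.le_succ s hs (s * g)
  rwa [hf.mul_cancel_left hs] at this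

theorem gen_le_one (hf : IsWordLength S f) {s : G} (hs : s ∈ S) : f s ≤ 1 := by
  have := hf.mul_le_succ hs 1
  rwa [mul_one, hf.one] at this

theorem mul_le (hf : IsWordLength S f) (g h : G) : f (g * h) ≤ f g + f h := by
  induction hn : f g generalizing g with
  | zero =>
    by_cases hg : g = 1
    · simp [hg]
    · obtain ⟨s, -, h2⟩ := hf.descent g hg
      omega
  | succ n ih =>
    have hg : g ≠ 1 := by
      rintro rfl
      rw [hf.one] at hn
      omega
    obtain ⟨s, hs, h2⟩ := hf.descent g hg
    have h3 := ih (s * g) (by omega)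
    have h4 := hf.le_succ s hs (g * h)
    rw [mul_assoc] at h3
    omega

theorem inv_le (hf : IsWordLength S f) (g : G) : f g⁻¹ ≤ f g := by
  induction hn : f g generalizing g with
  | zero =>
    by_cases hg : g = 1
    · simp [hg, hf.one]
    · obtain ⟨s, -, h2⟩ := hf.descent g hg
      omega
  | succ n ih =>
    have hg : g ≠ 1 := by
      rintro rfl
      rw [hf.one] at hn
      omega
    obtain ⟨s, hs, h2⟩ := hf.descent g hg
    have h3 := ih (s * g) (by omega)
    have h4 := hf.mul_le (s * g)⁻¹ s
    have h5 := hf.gen_le_one hs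
    rw [show (s * g)⁻¹ * s = g⁻¹ by rw [mul_inv_rev, mul_assoc, inv_mul_cancel, mul_one]] at h4
    omega

theorem inv (hf : IsWordLength S f) (g : G) : f g⁻¹ = f g :=
  le_antisymm (hf.inv_le g) (by simpa using hf.inv_le g⁻¹)

/-- Edges of the Cayley graph multiply on the right, while `IsWordLength` speaks of left
multiplication; taking inverses exchanges the two. -/
theorem le_walk_length (hf : IsWordLength S f) {u v : G} (w : (SimpleGraph.mulCayley S).Walk u v) :
    f u⁻¹ ≤ f v⁻¹ + w.length := by
  induction w with
  | nil => simp
  | @cons u v x huv w ih =>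
    rw [SimpleGraph.mulCayley_adj'] at huv
    obtain ⟨-, s, hs, h⟩ := huv
    have key : v⁻¹ = s * u⁻¹ := by
      rcases h with rfl | rfl
      · rw [mul_inv_rev, hf.inv_eq hs]
      · rw [mul_inv_rev, mul_inv_cancel_left]
    have := hf.le_succ s hs u⁻¹
    rw [← key] at this
    rw [SimpleGraph.Walk.length_cons]
    omega

theorem exists_walk (hf : IsWordLength S f) (g : G) :
    ∃ w : (SimpleGraph.mulCayley S).Walk g⁻¹ 1, w.length = f g := by
  induction hn : f g generalizing g with
  | zero =>
    by_cases hg : g = 1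
    · subst hg
      exact ⟨SimpleGraph.Walk.nil.copy (by simp) rfl, by simp⟩
    · obtain ⟨s, -, h2⟩ := hf.descent g hg
      omega
  | succ n ih =>
    have hg : g ≠ 1 := by
      rintro rfl
      rw [hf.one] at hn
      omega
    obtain ⟨s, hs, h2⟩ := hf.descent g hg
    obtain ⟨w, hw⟩ := ih (s * g) (by omega)
    have hadj : (SimpleGraph.mulCayley S).Adj g⁻¹ (s * g)⁻¹ := by
      rw [SimpleGraph.mulCayley_adj']
      refine ⟨fun h => ?_, s, hs, Or.inr ?_⟩
      · rw [inv_inj] at h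
        rw [← h] at h2
        omega
      · rw [mul_inv_rev, mul_assoc, inv_mul_cancel, mul_one]
    exact ⟨SimpleGraph.Walk.cons hadj w, by rw [SimpleGraph.Walk.length_cons, hw]⟩

theorem dist_eq (hf : IsWordLength S f) (g : G) : (SimpleGraph.mulCayley S).dist g 1 = f g := by
  have hex := hf.exists_walk g⁻¹
  rw [inv_inv, hf.inv] at hex
  obtain ⟨w, hw⟩ := hex
  refine le_antisymm ((SimpleGraph.dist_le w).trans hw.le) ?_
  obtain ⟨w', hw'⟩ := w.reachable.exists_walk_length_eq_dist
  have := hf.le_walk_length w'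
  rw [inv_one, hf.one, hf.inv] at this
  omega

end IsWordLength

/-! ### The tree as the set of reduced words, through the action of the free product on them. -/

section Tree

variable {q : ℕ}

/-- Reduced words in the letters. -/
abbrev Reduced (q : ℕ) : Type := {l : List (Fin q) // l.IsChain (· ≠ ·)}

/-- Left multiplication of a reduced word by a letter. -/
def Reduced.act (i : Fin q) (l : Reduced q) : Reduced q :=
  if h : l.1.head? = some i then ⟨l.1.tail, l.2.tail⟩
  else ⟨i :: l.1, by
    rw [List.isChain_cons]
    refine ⟨fun y hy hiy => h ?_, l.2⟩
    rw [hiy]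
    exact hy⟩

theorem Reduced.act_of_head {i : Fin q} {l : Reduced q} (h : l.1.head? = some i) :
    l.1 = i :: (Reduced.act i l).1 := by
  rw [Reduced.act, dif_pos h]
  exact (List.cons_head?_tail h).symm

theorem Reduced.act_of_head_ne {i : Fin q} {l : Reduced q} (h : l.1.head? ≠ some i) :
    (Reduced.act i l).1 = i :: l.1 := by
  rw [Reduced.act, dif_neg h]

theorem Reduced.head_act_of_head {i : Fin q} {l : Reduced q} (h : l.1.head? = some i) :
    (Reduced.act i l).1.head? ≠ some i := by
  intro h2
  have h3 := l.2
  rw [Reduced.act_of_head h, List.isChain_cons] at h3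
  exact h3.1 i h2 rfl

theorem Reduced.act_act (i : Fin q) (l : Reduced q) : Reduced.act i (Reduced.act i l) = l := by
  apply Subtype.ext
  by_cases h : l.1.head? = some i
  · rw [Reduced.act_of_head_ne (Reduced.head_act_of_head h), ← Reduced.act_of_head h]
  · have h2 := Reduced.act_of_head_ne h
    have h3 : (Reduced.act i l).1.head? = some i := by rw [h2]; rfl
    have := Reduced.act_of_head h3
    rw [h2] at this
    exact (List.cons.inj this).2.symm

/-- The action of the `i`-th free factor on reduced words. -/
def actHom (i : Fin q) : Multiplicative (ZMod 2) →* Equiv.Perm (Reduced q) where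
  toFun m := if m = 1 then 1 else (show Function.Involutive (Reduced.act i) from
    Reduced.act_act i).toPerm
  map_one' := if_pos rfl
  map_mul' a b := by
    have hs : ∀ σ : Equiv.Perm (Reduced q), σ * σ = 1 → ∀ a b : Multiplicative (ZMod 2),
        (if a * b = 1 then 1 else σ) = (if a = 1 then 1 else σ) * (if b = 1 then 1 else σ) := by
      intro σ hσ a b
      have key : ∀ a b : Multiplicative (ZMod 2),
          (a * b = 1 ↔ (a = 1 ↔ b = 1)) := by decide
      by_cases ha : a = 1 <;> by_cases hb : b = 1 <;> simp [ha, hb, key, hσ]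
    refine hs _ ?_ a b
    ext1 l
    exact Reduced.act_act i l

/-- The reduced word of a vertex. -/
def nf (x : Tree q) : Reduced q := Monoid.CoprodI.lift actHom x ⟨[], List.isChain_nil⟩

theorem nf_one : (nf (1 : Tree q)).1 = [] := by
  rw [nf, map_one]
  rfl

theorem nf_letter_mul (i : Fin q) (x : Tree q) : nf (letter i * x) = Reduced.act i (nf x) := by
  rw [nf, map_mul, letter, Monoid.CoprodI.lift_of]
  have : (Multiplicative.ofAdd (1 : ZMod 2)) ≠ 1 := by decide
  simp only [actHom, MonoidHom.coe_mk, OneHom.coe_mk, if_neg this, Equiv.Perm.mul_apply]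
  rfl

theorem letter_mul_self (i : Fin q) : (letter i : Tree q) * letter i = 1 := by
  rw [letter, ← map_mul]
  have : Multiplicative.ofAdd (1 : ZMod 2) * Multiplicative.ofAdd (1 : ZMod 2) = 1 := by decide
  rw [this, map_one]

theorem letter_inv (i : Fin q) : (letter i : Tree q)⁻¹ = letter i :=
  inv_eq_of_mul_eq_one_left (letter_mul_self i)

theorem letter_mul_cancel_left (i : Fin q) (x : Tree q) : letter i * (letter i * x) = x := by
  rw [← mul_assoc, letter_mul_self, one_mul]

theorem prod_nf (x : Tree q) : ((nf x).1.map letter).prod = x := by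
  induction x using Monoid.CoprodI.induction_left with
  | one => rw [nf_one]; rfl
  | @mul i m x ih =>
    have key : ∀ m : Multiplicative (ZMod 2), m = 1 ∨ m = Multiplicative.ofAdd 1 := by decide
    rcases key m with rfl | rfl
    · rwa [map_one, one_mul]
    · change ((nf (letter i * x)).1.map letter).prod = letter i * x
      rw [nf_letter_mul]
      by_cases h : (nf x).1.head? = some i
      · rw [Reduced.act_of_head h, List.map_cons, List.prod_cons] at ih
        rw [← ih, letter_mul_cancel_left, ih]
      · rw [Reduced.act_of_head_ne h, List.map_cons, List.prod_cons, ih]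

theorem nf_injective : Function.Injective (nf (q := q)) := fun x y h => by
  rw [← prod_nf x, h, prod_nf]

instance : Countable (Tree q) := nf_injective.countable

/-- The number of letters of the reduced word. -/
def len (x : Tree q) : ℕ := (nf x).1.length

/-- The first letter of the reduced word. -/
def hd (x : Tree q) : Option (Fin q) := (nf x).1.head?

theorem len_one : len (1 : Tree q) = 0 := by rw [len, nf_one]; rfl

theorem hd_one : hd (1 : Tree q) = none := by rw [hd, nf_one]; rfl

theorem hd_eq_none {x : Tree q} : hd x = none ↔ x = 1 := by
  refine ⟨fun h => ?_, fun h => by rw [h, hd_one]⟩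
  rw [hd, List.head?_eq_none_iff] at h
  rw [← prod_nf x, h]
  rfl

theorem exists_hd {x : Tree q} (hx : x ≠ 1) : ∃ i, hd x = some i :=
  Option.ne_none_iff_exists'.mp (mt hd_eq_none.mp hx)

theorem ne_one_of_hd {x : Tree q} {i : Fin q} (h : hd x = some i) : x ≠ 1 := by
  rintro rfl
  rw [hd_one] at h
  cases h

theorem len_letter_mul_of_hd {x : Tree q} {i : Fin q} (h : hd x = some i) :
    len (letter i * x) + 1 = len x := by
  rw [len, len, nf_letter_mul]
  conv_rhs => rw [Reduced.act_of_head h]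
  rfl

theorem len_letter_mul {x : Tree q} {i : Fin q} (h : hd x ≠ some i) :
    len (letter i * x) = len x + 1 := by
  rw [len, len, nf_letter_mul, Reduced.act_of_head_ne h]
  rfl

theorem hd_letter_mul_of_hd {x : Tree q} {i : Fin q} (h : hd x = some i) :
    hd (letter i * x) ≠ some i := by
  rw [hd, nf_letter_mul]
  exact Reduced.head_act_of_head h

theorem hd_letter_mul {x : Tree q} {i : Fin q} (h : hd x ≠ some i) :
    hd (letter i * x) = some i := by
  rw [hd, nf_letter_mul, Reduced.act_of_head_ne h]
  rfl

theorem hd_letter (i : Fin q) : hd (letter i : Tree q) = some i := by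
  rw [← mul_one (letter i)]
  exact hd_letter_mul (by rw [hd_one]; simp)

theorem len_letter (i : Fin q) : len (letter i : Tree q) = 1 := by
  rw [← mul_one (letter i), len_letter_mul (by rw [hd_one]; simp), len_one]

theorem letter_ne_one (i : Fin q) : (letter i : Tree q) ≠ 1 := ne_one_of_hd (hd_letter i)

theorem isWordLength_len : IsWordLength (Set.range (letter (q := q))) len where
  involutive := by
    rintro _ ⟨i, rfl⟩
    exact letter_mul_self i
  one := len_one
  le_succ := by
    rintro _ ⟨i, rfl⟩ x
    by_cases h : hd x = some i
    · exact (len_letter_mul_of_hd h).ge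
    · rw [len_letter_mul h]
      omega
  descent x hx := by
    obtain ⟨i, hi⟩ := exists_hd hx
    exact ⟨_, ⟨i, rfl⟩, len_letter_mul_of_hd hi⟩

theorem treeDist_eq_len (x : Tree q) : treeDist x = len x := isWordLength_len.dist_eq x

theorem len_inv (x : Tree q) : len x⁻¹ = len x := isWordLength_len.inv x

theorem len_mul_le (x y : Tree q) : len (x * y) ≤ len x + len y := isWordLength_len.mul_le x y

theorem len_eq_zero {x : Tree q} : len x = 0 ↔ x = 1 := by
  refine ⟨fun h => ?_, fun h => by rw [h, len_one]⟩
  by_contra hx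
  obtain ⟨i, hi⟩ := exists_hd hx
  have := len_letter_mul_of_hd hi
  omega

theorem len_mul_letter_of_last {x : Tree q} {i : Fin q} (h : hd x⁻¹ = some i) :
    len (x * letter i) + 1 = len x := by
  rw [← len_inv (x * letter i), mul_inv_rev, letter_inv, len_letter_mul_of_hd h, len_inv]

theorem len_mul_letter {x : Tree q} {i : Fin q} (h : hd x⁻¹ ≠ some i) :
    len (x * letter i) = len x + 1 := by
  rw [← len_inv (x * letter i), mul_inv_rev, letter_inv, len_letter_mul h, len_inv]

/-- A step to the right keeps the first letter, unless it leads back to the root. -/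
theorem hd_mul_letter {x : Tree q} {i j : Fin q} (h : hd x = some j) (hne : x ≠ letter i) :
    hd (x * letter i) = some j := by
  by_contra hcon
  have h1 := len_letter_mul_of_hd h
  have h2 := len_letter_mul hcon
  rw [← mul_assoc] at h2
  set u := letter j * x with hu
  have hx : x = letter j * u := by rw [hu, letter_mul_cancel_left]
  have h3 : len (u * letter i) ≤ len u + 1 := by
    simpa [len_letter] using len_mul_le u (letter i)
  have h4 : len x ≤ len (x * letter i) + 1 := by
    by_cases hl : hd x⁻¹ = some i
    · exact (len_mul_letter_of_last hl).ge
    · rw [len_mul_letter hl]; omega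
  by_cases hu1 : u = 1
  · have h5 : x = letter j := by rw [hx, hu1, mul_one]
    rw [hu1] at h1 h2 h3
    rw [len_one] at h1 h3
    have h7 := len_eq_zero.mp (show len (x * letter i) = 0 by omega)
    apply hne
    rw [← letter_inv i, ← mul_eq_one_iff_eq_inv, h7]
  -- Here `u` starts with some `k ≠ j`, and so does `u a_i`, since it is longer than `u`. Putting
  -- `a_j` back in front then lengthens `u a_i`, whereas `h2` says that `x a_i` is shorter.
  · obtain ⟨k, hk⟩ := exists_hd hu1
    have hkj : k ≠ j := by
      rintro rfl
      exact hd_letter_mul_of_hd h hk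
    have h5 := len_letter_mul_of_hd hk
    have h6 : len (letter k * (u * letter i)) ≤ len (letter k * u) + 1 := by
      rw [← mul_assoc]
      simpa [len_letter] using len_mul_le (letter k * u) (letter i)
    have h8 : hd (u * letter i) = some k := by
      by_contra h9
      have := len_letter_mul h9
      omega
    have h10 := len_letter_mul (x := u * letter i) (i := j) (by rw [h8]; simpa using hkj)
    rw [← mul_assoc, ← hx] at h10
    omega

end Tree

/-! ### The geodesic order and the branches at the root. -/

variable {q : ℕ}

/-- `y` lies on the geodesic from the root to `w`. -/
def Anc (y w : Tree q) : Prop := len w = len y + len (y⁻¹ * w)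

/-- Otherwise cancelling the first letter of `y` would shorten `y` but lengthen `w`, against the
triangle inequality. -/
theorem Anc.hd_eq {y w : Tree q} (hy : y ≠ 1) (h : Anc y w) : hd w = hd y := by
  obtain ⟨i, hi⟩ := exists_hd hy
  rw [hi]
  by_contra hw
  have h1 := len_letter_mul_of_hd hi
  have h2 := len_letter_mul hw
  have h3 := len_mul_le (letter i * y) (y⁻¹ * w)
  rw [show letter i * y * (y⁻¹ * w) = letter i * w by group] at h3
  rw [Anc] at h
  omega

theorem Anc.eq_one {y : Tree q} (h : Anc y 1) : y = 1 := by
  rw [Anc, len_one] at h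
  exact len_eq_zero.mp (by omega)

theorem Anc.letter_mul {y w : Tree q} (i : Fin q) (hy : y ≠ 1) (h : Anc y w) :
    Anc (letter i * y) (letter i * w) := by
  have hhd := h.hd_eq hy
  rw [Anc, show (letter i * y)⁻¹ * (letter i * w) = y⁻¹ * w by group]
  rw [Anc] at h
  by_cases hi : hd y = some i
  · have h1 := len_letter_mul_of_hd hi
    have h2 := len_letter_mul_of_hd (hhd.trans hi)
    omega
  · have h1 := len_letter_mul hi
    have h2 := len_letter_mul (x := w) (i := i) (by rwa [hhd])
    omega

/-- Translation by `a_i` exchanges `1` and `a_i`. Away from these two vertices it does not change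
which endpoint of an edge is the one farther from the root. -/
theorem anc_letter_mul_iff {y w : Tree q} {i : Fin q} (hy : y ≠ 1) (hyi : y ≠ letter i) :
    Anc (letter i * y) (letter i * w) ↔ Anc y w := by
  refine ⟨fun h => ?_, Anc.letter_mul i hy⟩
  have := h.letter_mul i (by
    rw [Ne, mul_eq_one_iff_inv_eq, letter_inv]
    exact hyi.symm)
  rwa [letter_mul_cancel_left, letter_mul_cancel_left] at this

theorem anc_letter_iff {w : Tree q} {i : Fin q} : Anc (letter i) w ↔ hd w = some i := by
  rw [Anc, len_letter, letter_inv]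
  refine ⟨fun h => ?_, fun h => by rw [← len_letter_mul_of_hd h, add_comm]⟩
  by_contra hw
  have := len_letter_mul hw
  omega

theorem finite_len_le (n : ℕ) : {y : Tree q | len y ≤ n}.Finite := by
  have h := (List.finite_length_le (Fin q) n).preimage
    ((Subtype.val_injective.comp (nf_injective (q := q))).injOn)
  exact h

/-- No lamp is lit in the branch at the neighbour `a_i` of the root. -/
def DarkIn (i : Fin q) (η : Tree q →₀ ZMod 2) : Prop := ∀ w, hd w = some i → η w = 0

/-- No lamp is lit outside the branch at the neighbour `a_i` of the root. -/
def DarkOut (i : Fin q) (η : Tree q →₀ ZMod 2) : Prop := ∀ w, hd w ≠ some i → η w = 0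

/-! ### The word length as the length of a shortest tour. -/

namespace Lamplighter

theorem move_mul_lamps (i : Fin q) (z : Lamplighter q) (w : Tree q) :
    (move i * z).lamps w = z.lamps (letter i * w) := by
  rw [mul_lamps, Finsupp.add_apply, shift_apply]
  simp only [move, letter_inv, Finsupp.coe_zero, Pi.zero_apply, zero_add]

theorem move_mul_pos (i : Fin q) (z : Lamplighter q) : (move i * z).pos = letter i * z.pos := rfl

theorem switch_mul_lamps (z : Lamplighter q) :
    (switch * z).lamps = Finsupp.single 1 1 + z.lamps := by
  ext w
  rw [mul_lamps, Finsupp.add_apply, shift_apply]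
  simp only [switch, inv_one, one_mul, Finsupp.add_apply]

theorem switch_mul_pos (z : Lamplighter q) : (switch * z).pos = z.pos := one_mul _

theorem mul_move_lamps (z : Lamplighter q) (i : Fin q) : (z * move i).lamps = z.lamps := by
  ext w
  rw [mul_lamps, Finsupp.add_apply, shift_apply]
  simp only [move, Finsupp.coe_zero, Pi.zero_apply, add_zero]

theorem mul_move_pos (z : Lamplighter q) (i : Fin q) : (z * move i).pos = z.pos * letter i := rfl

theorem mul_switch_lamps (z : Lamplighter q) (w : Tree q) :
    (z * switch).lamps w = z.lamps w + if w = z.pos then 1 else 0 := by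
  rw [mul_lamps, Finsupp.add_apply, shift_apply]
  simp only [switch, Finsupp.single_apply, eq_comm (a := (1 : Tree q)), inv_mul_eq_one,
    eq_comm (a := z.pos)]

theorem mul_switch_pos (z : Lamplighter q) : (z * switch).pos = z.pos := mul_one _

theorem switch_mul_self : (switch : Lamplighter q) * switch = 1 := by
  ext w
  · rw [switch_mul_lamps]
    simp only [switch, Finsupp.add_apply, one_lamps, Finsupp.coe_zero, Pi.zero_apply]
    exact CharTwo.add_self_eq_zero _
  · exact one_mul _

theorem move_mul_self (i : Fin q) : (move i : Lamplighter q) * move i = 1 := by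
  ext w
  · rw [move_mul_lamps]
    rfl
  · exact letter_mul_self i

/-- The edges (represented by their endpoint away from the root) that lead to a lit lamp, but are
not on the geodesic from the root to the position. -/
def detour (z : Lamplighter q) : Set (Tree q) :=
  {y | y ≠ 1 ∧ (∃ w, z.lamps w ≠ 0 ∧ Anc y w) ∧ ¬ Anc y z.pos}

theorem detour_finite (z : Lamplighter q) : z.detour.Finite := by
  refine (finite_len_le (z.lamps.support.sup len)).subset ?_
  rintro y ⟨-, ⟨w, hw, hy⟩, -⟩
  have h := Finset.le_sup (f := len) (Finsupp.mem_support_iff.mpr hw)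
  rw [Anc] at hy
  simp only [Set.mem_ofPred_eq]
  omega

theorem detour_switch_mul (z : Lamplighter q) : (switch * z).detour = z.detour := by
  have key : ∀ w : Tree q, w ≠ 1 → (switch * z).lamps w = z.lamps w := fun w hw => by
    rw [switch_mul_lamps, Finsupp.add_apply, Finsupp.single_eq_of_ne hw, zero_add]
  ext y
  simp only [detour, Set.mem_ofPred_eq, switch_mul_pos]
  refine and_congr_right fun hy => and_congr_left fun _ => exists_congr fun w => ?_
  refine and_congr_left fun hyw => ?_
  rw [key]
  rintro rfl
  exact hy hyw.eq_one

theorem mem_detour_move_mul {z : Lamplighter q} {i : Fin q} {y : Tree q} (hy : y ≠ 1)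
    (hyi : y ≠ letter i) : letter i * y ∈ (move i * z).detour ↔ y ∈ z.detour := by
  have h1 : letter i * y ≠ 1 := by
    rw [Ne, mul_eq_one_iff_inv_eq, letter_inv]
    exact hyi.symm
  simp only [detour, Set.mem_ofPred_eq, move_mul_pos, anc_letter_mul_iff hy hyi, h1, hy, ne_eq,
    not_false_eq_true, true_and]
  refine and_congr_left fun _ => ⟨?_, ?_⟩
  · rintro ⟨w, hw, h⟩
    rw [move_mul_lamps] at hw
    refine ⟨_, hw, ?_⟩
    rwa [← anc_letter_mul_iff hy hyi, letter_mul_cancel_left]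
  · rintro ⟨w, hw, h⟩
    refine ⟨letter i * w, ?_, (anc_letter_mul_iff hy hyi).mpr h⟩
    rwa [move_mul_lamps, letter_mul_cancel_left]

/-- Translation by `a_i` permutes the edges other than the one between the root and `a_i`, and keeps
their outer endpoints outer. The exceptional edge is represented by `a_i` both before and after. -/
theorem detour_move_mul_diff (z : Lamplighter q) (i : Fin q) :
    ((move i * z).detour \ {letter i}).ncard = (z.detour \ {letter i}).ncard := by
  rw [← Set.ncard_image_of_injective (z.detour \ {letter i}) (mul_right_injective (letter i))]
  congr 1
  ext y
  simp only [Set.mem_sdiff, Set.mem_singleton_iff, Set.mem_image]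
  constructor
  · rintro ⟨hy, hyi⟩
    have h2 : letter i * y ≠ letter i := fun h => hy.1 (mul_eq_left.mp h)
    have h1 : letter i * y ≠ 1 := by
      rw [Ne, mul_eq_one_iff_inv_eq, letter_inv]
      exact Ne.symm hyi
    refine ⟨letter i * y, ⟨?_, h2⟩, letter_mul_cancel_left i y⟩
    rwa [← mem_detour_move_mul h1 h2, letter_mul_cancel_left]
  · rintro ⟨x, ⟨hx, hxi⟩, rfl⟩
    exact ⟨(mem_detour_move_mul hx.1 hxi).mpr hx, fun h => hx.1 (mul_eq_left.mp h)⟩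

open Classical in
theorem ncard_detour (z : Lamplighter q) (i : Fin q) :
    z.detour.ncard = (z.detour \ {letter i}).ncard + if letter i ∈ z.detour then 1 else 0 := by
  split_ifs with h
  · exact (Set.ncard_sdiff_singleton_add_one h z.detour_finite).symm
  · rw [Set.sdiff_singleton_eq_self h, add_zero]

theorem letter_mem_detour {z : Lamplighter q} {i : Fin q} :
    letter i ∈ z.detour ↔ ¬ DarkIn i z.lamps ∧ hd z.pos ≠ some i := by
  simp only [detour, Set.mem_ofPred_eq, anc_letter_iff, letter_ne_one, ne_eq, not_false_eq_true,
    true_and, DarkIn, not_forall, exists_prop, and_comm]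

theorem darkIn_move_mul {z : Lamplighter q} {i : Fin q} :
    DarkIn i (move i * z).lamps ↔ DarkOut i z.lamps := by
  simp only [DarkIn, DarkOut, move_mul_lamps]
  constructor
  · intro h w hw
    have := h (letter i * w) (hd_letter_mul hw)
    rwa [letter_mul_cancel_left] at this
  · intro h w hw
    exact h _ (hd_letter_mul_of_hd hw)

/-- The number of steps of a shortest tour: twice the number of detour edges, plus the distance to
the position, plus the number of lit lamps. -/
noncomputable def tour (z : Lamplighter q) : ℕ :=
  2 * z.detour.ncard + len z.pos + z.lamps.support.card

theorem card_support_move_mul (z : Lamplighter q) (i : Fin q) :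
    (move i * z).lamps.support.card = z.lamps.support.card := by
  rw [← Finset.card_map (Equiv.mulLeft (letter i)).toEmbedding]
  congr 1
  ext w
  simp only [Finset.mem_map_equiv, Finsupp.mem_support_iff, move_mul_lamps, ne_eq]
  rw [Equiv.mulLeft_symm_apply, letter_inv, letter_mul_cancel_left]

-- A shortest tour crosses the edge between the root and `a_i` once if its start and its end are on
-- different sides; otherwise it crosses it twice, or not at all if the other side is dark. Moving
-- the start across the edge thus changes the number of crossings by one, and the darkness of the
-- side without the end decides the sign. The same holds in `tour_move_mul_of_hd`.
open Classical in
theorem tour_move_mul {z : Lamplighter q} {i : Fin q} (h : hd z.pos ≠ some i) :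
    (move i * z).tour + (if DarkIn i z.lamps then 0 else 2) = z.tour + 1 := by
  rw [tour, tour, ncard_detour _ i, ncard_detour z i, detour_move_mul_diff, letter_mem_detour,
    letter_mem_detour, card_support_move_mul, move_mul_pos, len_letter_mul h,
    if_neg (by simp [hd_letter_mul h])]
  split_ifs <;> first | omega | simp_all

open Classical in
theorem tour_move_mul_of_hd {z : Lamplighter q} {i : Fin q} (h : hd z.pos = some i) :
    (move i * z).tour + 1 = z.tour + if DarkOut i z.lamps then 0 else 2 := by
  have h1 := len_letter_mul_of_hd h
  have h2 := hd_letter_mul_of_hd h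
  rw [tour, tour, ncard_detour _ i, ncard_detour z i, detour_move_mul_diff, letter_mem_detour,
    letter_mem_detour, card_support_move_mul, move_mul_pos, darkIn_move_mul,
    if_neg (c := ¬ DarkIn i z.lamps ∧ hd z.pos ≠ some i) fun h' => h'.2 h]
  split_ifs <;> first | omega | simp_all

theorem tour_switch_mul_of_off {z : Lamplighter q} (h : z.lamps 1 = 0) :
    (switch * z).tour = z.tour + 1 := by
  rw [tour, tour, detour_switch_mul, switch_mul_pos, switch_mul_lamps]
  have : (Finsupp.single 1 1 + z.lamps).support = insert 1 z.lamps.support := by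
    ext w
    by_cases hw : w = 1
    · subst hw; simp [h]
    · simp [hw]
  rw [this, Finset.card_insert_of_notMem (by simpa using h)]
  omega

theorem tour_switch_mul_of_on {z : Lamplighter q} (h : z.lamps 1 ≠ 0) :
    (switch * z).tour + 1 = z.tour := by
  have h1 : (switch * z).lamps 1 = 0 := by
    have key : ∀ a : ZMod 2, a ≠ 0 → 1 + a = 0 := by decide
    rw [switch_mul_lamps, Finsupp.add_apply, Finsupp.single_eq_same, key _ h]
  have := tour_switch_mul_of_off h1
  rw [← mul_assoc, switch_mul_self, one_mul] at this
  exact this.symm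

/-- The descent is a greedy tour: switch off the lamp at the start, then clear the branches that do
not contain the final position, and only then walk towards that position, when everything left
behind is dark. -/
theorem isWordLength_tour :
    IsWordLength (insert (switch (q := q)) (Set.range (move (q := q)))) tour where
  involutive := by
    rintro _ (rfl | ⟨i, rfl⟩)
    · exact switch_mul_self
    · exact move_mul_self i
  one := by
    have : (1 : Lamplighter q).detour = ∅ := by
      ext y
      simp [detour, one_lamps]
    rw [tour, this, one_lamps, one_pos, len_one]
    simp
  le_succ := by
    classical
    rintro _ (rfl | ⟨i, rfl⟩) z
    · by_cases h : z.lamps 1 = 0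
      · have := tour_switch_mul_of_off h
        omega
      · exact (tour_switch_mul_of_on h).ge
    · by_cases h : hd z.pos = some i
      · have := tour_move_mul_of_hd h
        omega
      · have := tour_move_mul h
        split_ifs at this <;> omega
  descent z hz := by
    classical
    by_cases h1 : z.lamps 1 = 0
    swap
    · exact ⟨_, Or.inl rfl, tour_switch_mul_of_on h1⟩
    by_cases h2 : ∃ i, hd z.pos ≠ some i ∧ ¬ DarkIn i z.lamps
    · obtain ⟨i, hi, hd⟩ := h2
      have := tour_move_mul hi
      rw [if_neg hd] at this
      exact ⟨_, Or.inr ⟨i, rfl⟩, by omega⟩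
    push Not at h2
    by_cases h3 : z.pos = 1
    · exfalso
      apply hz
      ext w
      · by_cases hw : w = 1
        · rw [hw, h1]; rfl
        · obtain ⟨i, hi⟩ := exists_hd hw
          exact h2 i (by rw [h3, hd_one]; simp) w hi
      · exact h3
    · obtain ⟨i, hi⟩ := exists_hd h3
      have := tour_move_mul_of_hd hi
      rw [if_pos] at this
      · exact ⟨_, Or.inr ⟨i, rfl⟩, by omega⟩
      · intro w hw
        by_cases hw1 : w = 1
        · rw [hw1, h1]
        · obtain ⟨j, hj⟩ := exists_hd hw1
          refine h2 j ?_ w hj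
          rw [hi]
          rintro h
          rw [hj, ← h] at hw
          exact hw rfl

theorem length_eq_tour (z : Lamplighter q) : z.length = z.tour := isWordLength_tour.dist_eq z

end Lamplighter

open Lamplighter

/-! ### Averaging operators and expectations along the walk. -/

/-- The transition operator of the random walk: average over a step on the right. -/
noncomputable def stepR (p : ℝ) : (Lamplighter q → ℝ) →ₗ[ℝ] (Lamplighter q → ℝ) where
  toFun f z := p * f (z * switch) + (1 - p) / q * ∑ i, f (z * move i)
  map_add' f g := by
    ext z
    simp only [Pi.add_apply, Finset.sum_add_distrib]
    ring
  map_smul' c f := by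
    ext z
    simp only [Pi.smul_apply, smul_eq_mul, ← Finset.mul_sum, RingHom.id_apply]
    ring

/-- The average over a step on the left. -/
noncomputable def stepL (p : ℝ) : (Lamplighter q → ℝ) →ₗ[ℝ] (Lamplighter q → ℝ) where
  toFun f z := p * f (switch * z) + (1 - p) / q * ∑ i, f (move i * z)
  map_add' f g := by
    ext z
    simp only [Pi.add_apply, Finset.sum_add_distrib]
    ring
  map_smul' c f := by
    ext z
    simp only [Pi.smul_apply, smul_eq_mul, ← Finset.mul_sum, RingHom.id_apply]
    ring

theorem stepR_apply (p : ℝ) (f : Lamplighter q → ℝ) (z : Lamplighter q) :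
    stepR p f z = p * f (z * switch) + (1 - p) / q * ∑ i, f (z * move i) := rfl

theorem stepL_apply (p : ℝ) (f : Lamplighter q → ℝ) (z : Lamplighter q) :
    stepL p f z = p * f (switch * z) + (1 - p) / q * ∑ i, f (move i * z) := rfl

/-- The expectation of `f (Z_n)`. -/
noncomputable def mean (p : ℝ) (n : ℕ) : (Lamplighter q → ℝ) →ₗ[ℝ] ℝ :=
  LinearMap.proj 1 ∘ₗ (stepR p ^ n)

theorem mean_apply (p : ℝ) (n : ℕ) (f : Lamplighter q → ℝ) :
    mean p n f = (stepR p ^ n) f 1 := rfl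

theorem mean_zero (p : ℝ) (f : Lamplighter q → ℝ) : mean p 0 f = f 1 := rfl

theorem mean_succ (p : ℝ) (n : ℕ) (f : Lamplighter q → ℝ) :
    mean p (n + 1) f = mean p n (stepR p f) := by
  rw [mean_apply, pow_succ]
  rfl

theorem commute_stepL_stepR (p : ℝ) : Commute (stepL (q := q) p) (stepR p) := by
  refine LinearMap.ext fun f => funext fun z => ?_
  simp only [Module.End.mul_apply, stepL_apply, stepR_apply, mul_assoc, Finset.mul_sum,
    mul_add, Finset.sum_add_distrib]
  rw [Finset.sum_comm]
  ring_nf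

/-- Left and right multiplications commute, so the additional increment may be the first one. This
makes the drift of the length a local quantity at the root. -/
theorem mean_succ_left (p : ℝ) (n : ℕ) (f : Lamplighter q → ℝ) :
    mean p (n + 1) f = mean p n (stepL p f) := by
  have h := LinearMap.congr_fun ((commute_stepL_stepR (q := q) p).pow_right n) f
  rw [Module.End.mul_apply, Module.End.mul_apply] at h
  rw [mean_apply, mean_apply, ← h, pow_succ', Module.End.mul_apply, stepR_apply, stepL_apply]
  simp only [one_mul, mul_one]

theorem switch_inv : (switch : Lamplighter q)⁻¹ = switch :=
  inv_eq_of_mul_eq_one_left switch_mul_self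

theorem move_inv (i : Fin q) : (move i : Lamplighter q)⁻¹ = move i :=
  inv_eq_of_mul_eq_one_left (move_mul_self i)

/-- Inversion reverses the order of the increments, and the generators are involutions. -/
theorem mean_comp_inv (p : ℝ) (n : ℕ) (f : Lamplighter q → ℝ) :
    mean p n (fun z => f z⁻¹) = mean p n f := by
  induction n generalizing f with
  | zero => rw [mean_zero, mean_zero, inv_one]
  | succ n ih =>
    rw [mean_succ, mean_succ_left, ← ih (stepL p f)]
    congr 1
    ext z
    simp only [stepR_apply, stepL_apply, mul_inv_rev, switch_inv, move_inv]

theorem stepR_pow_mono {p : ℝ} (hp0 : 0 ≤ p) (hp1 : p ≤ 1) (n : ℕ) {f g : Lamplighter q → ℝ}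
    (h : ∀ z, f z ≤ g z) (z : Lamplighter q) : (stepR p ^ n) f z ≤ (stepR p ^ n) g z := by
  induction n generalizing f g with
  | zero => exact h z
  | succ n ih =>
    rw [pow_succ]
    refine ih fun z => ?_
    have : 0 ≤ (1 - p) / q := div_nonneg (by linarith) (Nat.cast_nonneg q)
    rw [stepR_apply, stepR_apply]
    gcongr <;> apply h

theorem mean_mono {p : ℝ} (hp0 : 0 ≤ p) (hp1 : p ≤ 1) (n : ℕ) {f g : Lamplighter q → ℝ}
    (h : ∀ z, f z ≤ g z) : mean p n f ≤ mean p n g := stepR_pow_mono hp0 hp1 n h 1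

theorem mean_nonneg {p : ℝ} (hp0 : 0 ≤ p) (hp1 : p ≤ 1) (n : ℕ) {f : Lamplighter q → ℝ}
    (h : ∀ z, 0 ≤ f z) : 0 ≤ mean p n f := by
  have := mean_mono hp0 hp1 n (f := 0) h
  rwa [map_zero] at this

theorem mean_const (hq : q ≠ 0) (p : ℝ) (n : ℕ) (c : ℝ) :
    mean p n (fun _ : Lamplighter q => c) = c := by
  have : stepR p (fun _ : Lamplighter q => c) = fun _ => c := by
    ext z
    have : (q : ℝ) ≠ 0 := Nat.cast_ne_zero.mpr hq
    simp only [stepR_apply, Finset.sum_const, Finset.card_univ, Fintype.card_fin, nsmul_eq_mul]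
    field_simp
    ring
  induction n with
  | zero => rfl
  | succ n ih => rw [mean_succ, this, ih]

theorem stepR_pow_translate (p : ℝ) (n : ℕ) (f : Lamplighter q → ℝ) (z w : Lamplighter q) :
    (stepR p ^ n) (fun y => f (z * y)) w = (stepR p ^ n) f (z * w) := by
  induction n generalizing f with
  | zero => rfl
  | succ n ih =>
    have h : stepR p (fun y => f (z * y)) = fun y => stepR p f (z * y) := by
      ext y
      simp only [stepR_apply, mul_assoc]
    rw [pow_succ, Module.End.mul_apply, Module.End.mul_apply, ← ih, h]

/-- Expectations of subadditive functions are subadditive. -/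
theorem mean_add_le (hq : q ≠ 0) {p : ℝ} (hp0 : 0 ≤ p) (hp1 : p ≤ 1) {f : Lamplighter q → ℝ}
    (hf : ∀ z w, f (z * w) ≤ f z + f w) (m n : ℕ) :
    mean p (m + n) f ≤ mean p m f + mean p n f := by
  have h : ∀ z, (stepR p ^ n) f z ≤ f z + mean p n f := by
    intro z
    have h1 : (stepR p ^ n) f z = mean p n (fun y => f (z * y)) := by
      rw [mean_apply, stepR_pow_translate, mul_one]
    have h2 := mean_mono hp0 hp1 n (hf z)
    have h3 : mean p n (fun w => f z + f w) = mean p n (fun _ => f z) + mean p n f :=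
      map_add (mean p n) (fun _ => f z) f
    rw [h3, mean_const hq] at h2
    rwa [h1]
  have h4 : mean p (m + n) f = mean p m ((stepR p ^ n) f) := by
    rw [mean_apply, pow_add]
    rfl
  have h5 : mean p m (fun z => f z + mean p n f) = mean p m f + mean p m (fun _ => mean p n f) :=
    map_add (mean p m) f (fun _ => mean p n f)
  rw [h4]
  refine (mean_mono hp0 hp1 m h).trans ?_
  rw [h5, mean_const hq]

/-- A function with a known Laplacian. -/
theorem mean_eq_of_stepR_eq {p : ℝ} {f g : Lamplighter q → ℝ} (h : stepR p f = f + g) (n : ℕ) :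
    mean p n f = f 1 + ∑ k ∈ Finset.range n, mean p k g := by
  induction n with
  | zero => simp [mean_zero]
  | succ n ih => rw [mean_succ, h, map_add, ih, Finset.sum_range_succ, add_assoc]

/-- In its application `g` is the indicator of an event at the root, so the sum is an expected
number of visits, which any subsolution of the Green equation bounds from below. -/
theorem le_mean_of_le_stepR {p : ℝ} (hp0 : 0 ≤ p) (hp1 : p ≤ 1) {f g : Lamplighter q → ℝ}
    (h : ∀ z, f z - g z ≤ stepR p f z) (n : ℕ) :
    f 1 - ∑ k ∈ Finset.range n, mean p k g ≤ mean p n f := by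
  induction n with
  | zero => simp [mean_zero]
  | succ n ih =>
    have h1 := mean_mono hp0 hp1 n h
    have h2 : mean p n (fun z => f z - g z) = mean p n f - mean p n g :=
      map_sub (mean p n) f g
    rw [mean_succ, Finset.sum_range_succ]
    linarith

/-! ### Functions on the tree that are radial on both sides of an edge -/

theorem sum_eq_of_ne (k : Fin q) (g : Fin q → ℝ) (B : ℝ) (h : ∀ i, i ≠ k → g i = B) :
    ∑ i, g i = g k + (q - 1) * B := by
  have hq : 1 ≤ q := by have := k.2; omega
  rw [← Finset.add_sum_erase _ _ (Finset.mem_univ k),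
    Finset.sum_congr rfl (fun i hi => h i (Finset.ne_of_mem_erase hi)), Finset.sum_const,
    Finset.card_erase_of_mem (Finset.mem_univ k), Finset.card_univ, Fintype.card_fin,
    nsmul_eq_mul, Nat.cast_sub hq, Nat.cast_one]

/-- The function equal to `g |x|` in the branch at `a_i`, and to `g' |x|` elsewhere. -/
noncomputable def sideFn (i : Fin q) (g g' : ℕ → ℝ) (x : Tree q) : ℝ :=
  if hd x = some i then g (len x) else g' (len x)

variable {i : Fin q} {g g' : ℕ → ℝ}

theorem sideFn_of_hd {x : Tree q} (h : hd x = some i) : sideFn i g g' x = g (len x) := if_pos h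

theorem sideFn_of_hd_ne {x : Tree q} (h : hd x ≠ some i) : sideFn i g g' x = g' (len x) := if_neg h

theorem sideFn_one : sideFn i g g' 1 = g' 0 := by
  rw [sideFn_of_hd_ne (by rw [hd_one]; simp), len_one]

theorem sum_sideFn_one : ∑ j, sideFn i g g' (1 * letter j) = g 1 + (q - 1) * g' 1 := by
  rw [sum_eq_of_ne i _ (g' 1) fun j hj => ?_, one_mul, sideFn_of_hd (hd_letter i), len_letter]
  rw [one_mul, sideFn_of_hd_ne (by rw [hd_letter]; simpa using hj), len_letter]

theorem sum_sideFn_letter : ∑ j, sideFn i g g' (letter i * letter j) = g' 0 + (q - 1) * g 2 := by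
  rw [sum_eq_of_ne i _ (g 2) fun j hj => ?_, letter_mul_self, sideFn_one]
  have h : hd (letter j : Tree q) ≠ some i := by rw [hd_letter]; simpa using hj
  rw [sideFn_of_hd (hd_letter_mul h), len_letter_mul h, len_letter]

theorem sum_len_mul_letter (g : ℕ → ℝ) {x : Tree q} {m : ℕ} (hm : len x = m + 1) :
    ∑ j, g (len (x * letter j)) = g m + (q - 1) * g (m + 2) := by
  have hx : x⁻¹ ≠ 1 := by
    rw [Ne, inv_eq_one, ← len_eq_zero]
    omega
  obtain ⟨k, hk⟩ := exists_hd hx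
  have h1 := len_mul_letter_of_last hk
  rw [sum_eq_of_ne k _ (g (m + 2)) fun j hj => ?_, show len (x * letter k) = m by omega]
  rw [len_mul_letter (by rw [hk]; simpa using hj.symm), hm]

theorem sum_sideFn_of_hd {x : Tree q} {m : ℕ} (h : hd x = some i) (hne : x ≠ letter i)
    (hm : len x = m + 1) :
    ∑ j, sideFn i g g' (x * letter j) = g m + (q - 1) * g (m + 2) := by
  rw [← sum_len_mul_letter g hm]
  refine Finset.sum_congr rfl fun j _ => sideFn_of_hd (hd_mul_letter h ?_)
  rintro rfl
  rw [hd_letter] at h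
  exact hne (by rw [Option.some.inj h])

theorem sum_sideFn_of_hd_ne {x : Tree q} {m : ℕ} (h : hd x ≠ some i) (hm : len x = m + 1) :
    ∑ j, sideFn i g g' (x * letter j) = g' m + (q - 1) * g' (m + 2) := by
  rw [← sum_len_mul_letter g' hm]
  refine Finset.sum_congr rfl fun j _ => sideFn_of_hd_ne ?_
  have hx : x ≠ 1 := by
    rw [Ne, ← len_eq_zero]
    omega
  obtain ⟨k, hk⟩ := exists_hd hx
  by_cases hxj : x = letter j
  · rw [hxj, letter_mul_self, hd_one]
    simp
  · rw [hd_mul_letter hk hxj, ← hk]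
    exact h

theorem sum_radial_one (g : ℕ → ℝ) : ∑ j : Fin q, g (len (1 * letter j)) = q * g 1 := by
  simp only [one_mul, len_letter, Finset.sum_const, Finset.card_univ, Fintype.card_fin,
    nsmul_eq_mul]

/-! ### Hitting probabilities and transience. -/

/-- The probability `1 / (q - 1)` to ever hit a given neighbour. -/
noncomputable def hit (q : ℕ) : ℝ := 1 / (q - 1)

theorem cast_ge_three (hq : 3 ≤ q) : (3 : ℝ) ≤ q := by exact_mod_cast hq

theorem sub_one_mul_hit (hq : 3 ≤ q) : ((q : ℝ) - 1) * hit q = 1 := by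
  have := cast_ge_three hq
  rw [hit, mul_one_div_cancel]
  linarith

theorem hit_pos (hq : 3 ≤ q) : 0 < hit q := by
  have := cast_ge_three hq
  exact one_div_pos.mpr (by linarith)

theorem hit_lt_one (hq : 3 ≤ q) : hit q < 1 := by
  have h1 := sub_one_mul_hit hq
  have h2 := hit_pos hq
  have := cast_ge_three hq
  nlinarith

/-- This is the harmonicity of `x ↦ F^|x|` away from the root; all harmonic functions below rest on
it. -/
theorem hit_pow_add (hq : 3 ≤ q) (m : ℕ) :
    hit q ^ m + ((q : ℝ) - 1) * hit q ^ (m + 2) = q * hit q ^ (m + 1) := by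
  linear_combination (hit q ^ (m + 1) - hit q ^ m) * sub_one_mul_hit hq

theorem step_average (hq : 3 ≤ q) (p : ℝ) {A S : ℝ} (h : S = q * A) :
    p * A + (1 - p) / q * S = A := by
  have := cast_ge_three hq
  rw [h]
  field_simp
  ring

theorem stepR_mul_apply (p : ℝ) (C : (Tree q →₀ ZMod 2) → ℝ) (v : Tree q → ℝ)
    (z : Lamplighter q) :
    stepR p (fun z => C z.lamps * v z.pos) z = p * (C (z * switch).lamps * v z.pos) +
      (1 - p) / q * (C z.lamps * ∑ j, v (z.pos * letter j)) := by
  simp only [stepR_apply, mul_switch_pos, mul_move_pos, mul_move_lamps, Finset.mul_sum]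

theorem exists_len_eq_succ {x : Tree q} (hx : x ≠ 1) : ∃ m, len x = m + 1 :=
  Nat.exists_eq_succ_of_ne_zero (mt len_eq_zero.mp hx)

/-- The probability to hit the root from the position of `z`. -/
noncomputable def hitRoot (z : Lamplighter q) : ℝ := hit q ^ len z.pos

theorem hitRoot_nonneg (hq : 3 ≤ q) (z : Lamplighter q) : 0 ≤ hitRoot z :=
  pow_nonneg (hit_pos hq).le _

/-- The radial function `t^|x|` is contracted by each step with factor `p + (1 - p) s`: away from
the root by `hs`, at the root by `hts`. -/
theorem mean_pow_len_le (hq : 3 ≤ q) {p t s : ℝ} (hp0 : 0 ≤ p) (hp1 : p ≤ 1) (ht : 0 ≤ t)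
    (hts : t ≤ s) (hs : 1 + (q - 1) * t ^ 2 ≤ q * s * t) (n : ℕ) :
    mean p n (fun z : Lamplighter q => t ^ len z.pos) ≤ (p + (1 - p) * s) ^ n := by
  have hq3 := cast_ge_three hq
  have h1p : 0 ≤ 1 - p := by linarith
  have hpow : 0 ≤ p + (1 - p) * s := by
    have : 0 ≤ s := ht.trans hts
    positivity
  have key : ∀ z : Lamplighter q, stepR p (fun z => t ^ len z.pos) z ≤
      (p + (1 - p) * s) * t ^ len z.pos := by
    intro z
    have h := stepR_mul_apply p (fun _ => 1) (fun x => t ^ len x) z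
    simp only [one_mul] at h
    rw [h, add_mul]
    refine add_le_add le_rfl ?_
    by_cases hz : z.pos = 1
    · rw [hz, sum_radial_one (fun m => t ^ m), len_one]
      calc (1 - p) / q * (q * t ^ 1) = (1 - p) * t := by field_simp
        _ ≤ (1 - p) * s * t ^ 0 := by
          rw [pow_zero, mul_one]
          gcongr
    · obtain ⟨m, hm⟩ := exists_len_eq_succ hz
      rw [sum_len_mul_letter (fun m => t ^ m) hm, hm]
      calc (1 - p) / q * (t ^ m + (q - 1) * t ^ (m + 2))
          = (1 - p) / q * (t ^ m * (1 + (q - 1) * t ^ 2)) := by ring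
        _ ≤ (1 - p) / q * (t ^ m * (q * s * t)) := by gcongr
        _ = (1 - p) * s * t ^ (m + 1) := by
          field_simp
          ring
  induction n with
  | zero => simp [mean_zero, Lamplighter.one_pos, len_one]
  | succ n ih =>
    rw [mean_succ, pow_succ']
    refine (mean_mono hp0 hp1 n key).trans ?_
    have h2 : mean p n (fun z : Lamplighter q => (p + (1 - p) * s) * t ^ len z.pos) =
        (p + (1 - p) * s) * mean p n (fun z : Lamplighter q => t ^ len z.pos) :=
      map_smul (mean p n) _ _
    rw [h2]
    gcongr

theorem tendsto_mean_hitRoot (hq : 3 ≤ q) {p : ℝ} (hp0 : 0 < p) (hp1 : p < 1) :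
    Tendsto (fun n => mean p n (hitRoot (q := q))) atTop (𝓝 0) := by
  have hq3 := cast_ge_three hq
  have hq1 : (0 : ℝ) < q - 1 := by linarith
  -- The roots of `1 + (q-1) t² = q t` are `1/(q-1)` and `1`. Their midpoint is taken as `t`, and
  -- `s` makes `hs` an equality; so `s < 1`.
  set t : ℝ := q / (2 * (q - 1)) with ht
  set s : ℝ := 2 * (q - 1) / q ^ 2 + 1 / 2 with hs
  have ht0 : 0 < t := by positivity
  have ht1 : t < 1 := by
    rw [ht, div_lt_one (by positivity)]
    linarith
  have hs1 : s < 1 := by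
    have : 2 * ((q : ℝ) - 1) / q ^ 2 < 1 / 2 := by
      rw [div_lt_div_iff₀ (by positivity) (by norm_num)]
      nlinarith
    linarith
  have hst : 1 + ((q : ℝ) - 1) * t ^ 2 = q * s * t := by
    rw [ht, hs]
    field_simp
  have hts : t ≤ s := by
    have : (q : ℝ) * t * t ≤ q * s * t := by nlinarith
    exact le_of_mul_le_mul_left (le_of_mul_le_mul_right this ht0) (by linarith)
  have hs0 : 0 < s := ht0.trans_le hts
  have hht : hit q ≤ t := by
    rw [hit, ht, div_le_div_iff₀ hq1 (by positivity)]
    nlinarith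
  refine squeeze_zero (fun n => mean_nonneg hp0.le hp1.le n (hitRoot_nonneg hq))
    (fun n => (mean_mono hp0.le hp1.le n fun z => ?_).trans
      (mean_pow_len_le hq hp0.le hp1.le ht0.le hts hst.le n))
    (tendsto_pow_atTop_nhds_zero_of_lt_one ?_ ?_)
  · exact pow_le_pow_left₀ (hit_pos hq).le hht _
  · have : 0 < 1 - p := by linarith
    positivity
  · nlinarith

/-! ### The lamp at the root -/

/-- The sign attached to a lamp. -/
noncomputable def sgn (a : ZMod 2) : ℝ := if a = 0 then 1 else -1

theorem sgn_add_one (a : ZMod 2) : sgn (a + 1) = -sgn a := by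
  have h : ∀ a : ZMod 2, a + 1 = 0 ↔ ¬ a = 0 := by decide
  by_cases ha : a = 0 <;> simp [sgn, h, ha]

theorem abs_sgn (a : ZMod 2) : |sgn a| = 1 := by
  rw [sgn]
  split_ifs <;> simp

/-- Twice the probability that the lamp at the root is finally lit. -/
noncomputable def lit (q : ℕ) (p : ℝ) : ℝ := 2 * p * (q - 1) / (p * q + q - 2)

theorem lit_pos (hq : 3 ≤ q) {p : ℝ} (hp0 : 0 < p) : 0 < lit q p := by
  have := cast_ge_three hq
  have : (0 : ℝ) < q - 1 := by linarith
  exact div_pos (by positivity) (by nlinarith)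

theorem lit_le_one (hq : 3 ≤ q) {p : ℝ} (hp0 : 0 < p) (hp1 : p < 1) : lit q p ≤ 1 := by
  have := cast_ge_three hq
  rw [lit, div_le_one (by nlinarith)]
  nlinarith

/-- The factor `1 - lit · F^|x|` corrects for the future flips of the lamp at the root, which
require a visit there. Harmonicity at the root amounts to `lit (1 + p - (1-p) F) = 2p`, which
determines `lit`. -/
theorem stepR_sgn_harmonic (hq : 3 ≤ q) {p : ℝ} (hp0 : 0 < p) :
    stepR p (fun z : Lamplighter q => sgn (z.lamps 1) * (1 - lit q p * hit q ^ len z.pos)) =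
      (fun z : Lamplighter q => sgn (z.lamps 1) * (1 - lit q p * hit q ^ len z.pos)) + 0 := by
  have hq3 := cast_ge_three hq
  ext z
  rw [stepR_mul_apply p (fun η => sgn (η 1)) (fun x => 1 - lit q p * hit q ^ len x), add_zero,
    mul_switch_lamps]
  by_cases hz : z.pos = 1
  · rw [if_pos hz.symm, hz, sum_radial_one (fun m => 1 - lit q p * hit q ^ m), sgn_add_one, len_one]
    have hd : p * q + q - 2 ≠ 0 := by nlinarith
    have hd1 : (q : ℝ) - 1 ≠ 0 := by linarith
    have h1 : lit q p * (p * q + q - 2) = 2 * p * (q - 1) := div_mul_cancel₀ _ hd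
    have h2 : lit q p * (1 + p - (1 - p) * hit q) = 2 * p := by
      refine mul_left_cancel₀ hd1 ?_
      linear_combination h1 - lit q p * (1 - p) * sub_one_mul_hit hq
    have h3 : (1 - p) / q * (q : ℝ) = 1 - p := div_mul_cancel₀ _ (by linarith)
    linear_combination sgn (z.lamps 1) * (1 - lit q p * hit q) * h3 + sgn (z.lamps 1) * h2
  · obtain ⟨m, hm⟩ := exists_len_eq_succ hz
    rw [if_neg (Ne.symm hz), add_zero, sum_len_mul_letter (fun m => 1 - lit q p * hit q ^ m) hm, hm]
    refine step_average hq p ?_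
    linear_combination -(sgn (z.lamps 1) * lit q p) * hit_pow_add hq m

/-- The expected sign of the lamp at the root converges with an explicit rate. -/
theorem abs_mean_sgn_sub_le (hq : 3 ≤ q) {p : ℝ} (hp0 : 0 < p) (hp1 : p < 1) (n : ℕ) :
    |mean p n (fun z : Lamplighter q => sgn (z.lamps 1)) - (1 - lit q p)| ≤
      mean p n (hitRoot (q := q)) := by
  have h1 := mean_eq_of_stepR_eq (stepR_sgn_harmonic hq hp0) n
  simp only [map_zero, Finset.sum_const_zero, add_zero, one_lamps, one_pos, len_one, pow_zero,
    mul_one, sgn, Finsupp.coe_zero, Pi.zero_apply, if_true, one_mul] at h1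
  have h2 : mean p n (fun z : Lamplighter q => sgn (z.lamps 1)) =
      mean p n (fun z : Lamplighter q => sgn (z.lamps 1) * (1 - lit q p * hit q ^ len z.pos)) +
      mean p n (fun z : Lamplighter q => sgn (z.lamps 1) * (lit q p * hit q ^ len z.pos)) := by
    rw [← map_add]
    congr 1
    ext z
    simp only [Pi.add_apply]
    ring
  have hb : ∀ z : Lamplighter q, |sgn (z.lamps 1) * (lit q p * hit q ^ len z.pos)| ≤ hitRoot z := by
    intro z
    have : 0 ≤ hit q ^ len z.pos := hitRoot_nonneg hq z
    rw [abs_mul, abs_sgn, one_mul, abs_of_nonneg (mul_nonneg (lit_pos hq hp0).le this)]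
    exact mul_le_of_le_one_left this (lit_le_one hq hp0 hp1)
  have h3 := mean_mono hp0.le hp1.le n fun z => (abs_le.mp (hb z)).2
  have h4 := mean_mono hp0.le hp1.le n fun z => (abs_le.mp (hb z)).1
  have h5 : mean p n (fun z => -hitRoot (q := q) z) = -mean p n hitRoot :=
    map_neg (mean p n) hitRoot
  rw [h5] at h4
  simp only [sgn] at h2 h3 h4 ⊢
  rw [h2, h1, abs_le]
  constructor <;> linarith

/-! ### Dark branches -/

theorem darkIn_mul_switch {i : Fin q} {z : Lamplighter q} (h : hd z.pos ≠ some i) :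
    DarkIn i (z * switch).lamps ↔ DarkIn i z.lamps := by
  refine forall_congr' fun w => forall_congr' fun hw => ?_
  rw [mul_switch_lamps, if_neg, add_zero]
  rintro rfl
  exact h hw

theorem darkOut_mul_switch {i : Fin q} {z : Lamplighter q} (h : hd z.pos = some i) :
    DarkOut i (z * switch).lamps ↔ DarkOut i z.lamps := by
  refine forall_congr' fun w => forall_congr' fun hw => ?_
  rw [mul_switch_lamps, if_neg, add_zero]
  rintro rfl
  exact hw h

open Classical in
/-- The indicator of a branch being dark. -/
noncomputable def darkIn (i : Fin q) (η : Tree q →₀ ZMod 2) : ℝ := if DarkIn i η then 1 else 0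

open Classical in
/-- The indicator of the complement of a branch being dark. -/
noncomputable def darkOut (i : Fin q) (η : Tree q →₀ ZMod 2) : ℝ := if DarkOut i η then 1 else 0

theorem darkIn_nonneg (i : Fin q) (η : Tree q →₀ ZMod 2) : 0 ≤ darkIn i η := by
  rw [darkIn]; split_ifs <;> norm_num

theorem darkIn_le_one (i : Fin q) (η : Tree q →₀ ZMod 2) : darkIn i η ≤ 1 := by
  rw [darkIn]; split_ifs <;> norm_num

theorem darkOut_nonneg (i : Fin q) (η : Tree q →₀ ZMod 2) : 0 ≤ darkOut i η := by
  rw [darkOut]; split_ifs <;> norm_num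

theorem darkOut_le_one (i : Fin q) (η : Tree q →₀ ZMod 2) : darkOut i η ≤ 1 := by
  rw [darkOut]; split_ifs <;> norm_num

open Classical in
/-- The indicator of a vertex. -/
noncomputable def atVertex (y x : Tree q) : ℝ := if x = y then 1 else 0

/-- From distance `m` to the root outside the branch, `1 - F^(m+1)` is the probability never to hit
`a_i`. Switches there do not affect `darkIn i`, so the only charge is at `a_i`, from where the walk
can leave the branch. -/
theorem stepR_darkIn (hq : 3 ≤ q) (p : ℝ) (i : Fin q) :
    stepR p (fun z => darkIn i z.lamps * sideFn i 0 (fun m => 1 - hit q ^ (m + 1)) z.pos) =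
      (fun z => darkIn i z.lamps * sideFn i 0 (fun m => 1 - hit q ^ (m + 1)) z.pos) +
      ((1 - p) / q * (1 - hit q)) • fun z => darkIn i z.lamps * atVertex (letter i) z.pos := by
  ext z
  rw [stepR_mul_apply p (darkIn i), Pi.add_apply, Pi.smul_apply, smul_eq_mul]
  by_cases h : hd z.pos = some i
  · have hs : sideFn i 0 (fun m => 1 - hit q ^ (m + 1)) z.pos = 0 := sideFn_of_hd h
    by_cases hx : z.pos = letter i
    · rw [hs, hx, sum_sideFn_letter, atVertex, if_pos rfl]
      simp only [Pi.zero_apply]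
      ring
    · obtain ⟨m, hm⟩ := exists_len_eq_succ (ne_one_of_hd h)
      rw [hs, sum_sideFn_of_hd h hx hm, atVertex, if_neg hx]
      simp
  · have hsw : darkIn i (z * switch).lamps = darkIn i z.lamps := by
      rw [darkIn, darkIn, propext (darkIn_mul_switch h)]
    have hx : z.pos ≠ letter i := fun hx => h (by rw [hx, hd_letter])
    rw [hsw, atVertex, if_neg hx, mul_zero, mul_zero, add_zero]
    refine step_average hq p ?_
    by_cases h1 : z.pos = 1
    · rw [h1, sum_sideFn_one, sideFn_one]
      simp only [Pi.zero_apply]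
      linear_combination darkIn i z.lamps * (1 - hit q) * sub_one_mul_hit hq
    · obtain ⟨m, hm⟩ := exists_len_eq_succ h1
      rw [sum_sideFn_of_hd_ne h hm, sideFn_of_hd_ne h, hm]
      linear_combination -darkIn i z.lamps * hit_pow_add hq (m + 1)

/-- The mirror image of `stepR_darkIn`: `1 - F^m` is the probability never to return from the branch
to the root, and the charge sits at the root. -/
theorem stepR_darkOut (hq : 3 ≤ q) (p : ℝ) (i : Fin q) :
    stepR p (fun z => darkOut i z.lamps * sideFn i (fun m => 1 - hit q ^ m) 0 z.pos) =
      (fun z => darkOut i z.lamps * sideFn i (fun m => 1 - hit q ^ m) 0 z.pos) +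
      ((1 - p) / q * (1 - hit q)) • fun z => darkOut i z.lamps * atVertex 1 z.pos := by
  ext z
  rw [stepR_mul_apply p (darkOut i), Pi.add_apply, Pi.smul_apply, smul_eq_mul]
  by_cases h : hd z.pos = some i
  · have hsw : darkOut i (z * switch).lamps = darkOut i z.lamps := by
      rw [darkOut, darkOut, propext (darkOut_mul_switch h)]
    rw [hsw, atVertex, if_neg (ne_one_of_hd h), mul_zero, mul_zero, add_zero]
    refine step_average hq p ?_
    by_cases hx : z.pos = letter i
    · rw [hx, sum_sideFn_letter, sideFn_of_hd (hd_letter i), len_letter]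
      simp only [Pi.zero_apply]
      linear_combination darkOut i z.lamps * (1 - hit q) * sub_one_mul_hit hq
    · obtain ⟨m, hm⟩ := exists_len_eq_succ (ne_one_of_hd h)
      rw [sum_sideFn_of_hd h hx hm, sideFn_of_hd h, hm]
      linear_combination -darkOut i z.lamps * hit_pow_add hq m
  · have hs : sideFn i (fun m => 1 - hit q ^ m) 0 z.pos = 0 := sideFn_of_hd_ne h
    by_cases h1 : z.pos = 1
    · rw [hs, h1, sum_sideFn_one, atVertex, if_pos rfl]
      simp only [Pi.zero_apply]
      ring
    · obtain ⟨m, hm⟩ := exists_len_eq_succ h1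
      rw [hs, sum_sideFn_of_hd_ne h hm, atVertex, if_neg h1]
      simp

/-- The return probability `F^m` has charges of opposite sign at both ends of the edge. Hence, up to
an error, visits to `a_i` with dark complement are `F` times as many as visits to the root with dark
complement. -/
theorem stepR_darkOut_hit (hq : 3 ≤ q) (p : ℝ) (i : Fin q) :
    stepR p (fun z => darkOut i z.lamps * sideFn i (fun m => hit q ^ m) 0 z.pos) =
      (fun z => darkOut i z.lamps * sideFn i (fun m => hit q ^ m) 0 z.pos) +
      ((1 - p) / q) • (hit q • (fun z => darkOut i z.lamps * atVertex 1 z.pos) -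
        fun z => darkOut i z.lamps * atVertex (letter i) z.pos) := by
  ext z
  rw [stepR_mul_apply p (darkOut i), Pi.add_apply, Pi.smul_apply, Pi.sub_apply, Pi.smul_apply,
    smul_eq_mul, smul_eq_mul]
  by_cases h : hd z.pos = some i
  · have hsw : darkOut i (z * switch).lamps = darkOut i z.lamps := by
      rw [darkOut, darkOut, propext (darkOut_mul_switch h)]
    rw [hsw, atVertex, atVertex, if_neg (ne_one_of_hd h)]
    by_cases hx : z.pos = letter i
    · rw [if_pos hx, hx, sum_sideFn_letter, sideFn_of_hd (hd_letter i), len_letter]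
      have h3 := step_average hq p (A := darkOut i z.lamps * hit q)
        (S := darkOut i z.lamps * (1 + hit q))
        (by linear_combination -darkOut i z.lamps * sub_one_mul_hit hq)
      simp only [Pi.zero_apply]
      linear_combination h3 + (1 - p) / q * darkOut i z.lamps * hit q * sub_one_mul_hit hq
    · obtain ⟨m, hm⟩ := exists_len_eq_succ (ne_one_of_hd h)
      rw [if_neg hx, sum_sideFn_of_hd h hx hm, sideFn_of_hd h, hm, mul_zero, mul_zero, sub_zero,
        mul_zero, add_zero]
      refine step_average hq p ?_
      linear_combination darkOut i z.lamps * hit_pow_add hq m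
  · have hs : sideFn i (fun m => hit q ^ m) 0 z.pos = 0 := sideFn_of_hd_ne h
    have hx : z.pos ≠ letter i := fun hx => h (by rw [hx, hd_letter])
    by_cases h1 : z.pos = 1
    · rw [hs, h1, sum_sideFn_one, atVertex, if_pos rfl, atVertex, if_neg (letter_ne_one i).symm]
      simp only [Pi.zero_apply]
      ring
    · obtain ⟨m, hm⟩ := exists_len_eq_succ h1
      rw [hs, sum_sideFn_of_hd_ne h hm, atVertex, if_neg h1, atVertex, if_neg hx]
      simp

/-- For an element at position `a_i`, inversion translates the lamps by `a_i` and so exchanges the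
two sides of the edge. -/
theorem mean_darkIn_letter (p : ℝ) (n : ℕ) (i : Fin q) :
    mean p n (fun z => darkIn i z.lamps * atVertex (letter i) z.pos) =
      mean p n (fun z => darkOut i z.lamps * atVertex (letter i) z.pos) := by
  rw [← mean_comp_inv]
  congr 1
  ext z
  simp only [atVertex, inv_pos, inv_eq_iff_eq_inv, letter_inv]
  by_cases h : z.pos = letter i
  · have : DarkIn i (z⁻¹).lamps ↔ DarkOut i z.lamps := by
      rw [← darkIn_move_mul]
      refine forall_congr' fun w => forall_congr' fun _ => ?_
      rw [move_mul_lamps, inv_lamps, shift_apply, inv_inv, h]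
    rw [darkIn, darkOut, propext this]
  · simp [h]

/-- The indicator that the position is outside a branch, which is dark. -/
noncomputable def leaveIn (i : Fin q) (z : Lamplighter q) : ℝ :=
  darkIn i z.lamps * sideFn i 0 1 z.pos

/-- The indicator that the position is inside a branch, whose complement is dark. -/
noncomputable def leaveOut (i : Fin q) (z : Lamplighter q) : ℝ :=
  darkOut i z.lamps * sideFn i 1 0 z.pos

/-- Both ways of leaving a dark side of an edge are related by time reversal. -/
theorem abs_mean_leave_sub_le (hq : 3 ≤ q) {p : ℝ} (hp0 : 0 < p) (hp1 : p < 1) (n : ℕ)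
    (i : Fin q) :
    |mean p n (leaveIn i) - mean p n (leaveOut i) - (1 - hit q) * (1 - mean p n (leaveOut i))| ≤
      mean p n (hitRoot (q := q)) := by
  have hq3 := cast_ge_three hq
  have e1 := mean_eq_of_stepR_eq (stepR_darkIn hq p i) n
  have e2 := mean_eq_of_stepR_eq (stepR_darkOut hq p i) n
  have e3 := mean_eq_of_stepR_eq (stepR_darkOut_hit hq p i) n
  -- Time reversal turns the visits in `e1` into those of `e3`, so that the same sum `A` occurs in
  -- both.
  simp only [map_smul, map_sub, smul_eq_mul, mean_darkIn_letter, ← Finset.mul_sum,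
    Finset.sum_sub_distrib, one_pos, sideFn_one, one_lamps] at e1 e2 e3
  have hd1 : darkIn i (0 : Tree q →₀ ZMod 2) = 1 := if_pos fun w _ => rfl
  rw [hd1, zero_add, pow_one, one_mul] at e1
  rw [Pi.zero_apply, mul_zero, zero_add] at e2 e3
  set A := ∑ k ∈ Finset.range n, mean p k
    (fun z => darkOut i z.lamps * atVertex (letter i) z.pos)
  set B := ∑ k ∈ Finset.range n, mean p k (fun z => darkOut i z.lamps * atVertex 1 z.pos)
  set ψ : Lamplighter q → ℝ := fun z => darkOut i z.lamps * sideFn i (fun m => hit q ^ m) 0 z.pos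
    with hψ
  set χ : Lamplighter q → ℝ := fun z => darkIn i z.lamps * sideFn i 0 (fun m => hit q ^ m) z.pos
    with hχ
  have f1 : mean p n (leaveIn i) = mean p n (fun z => darkIn i z.lamps *
      sideFn i 0 (fun m => 1 - hit q ^ (m + 1)) z.pos) + hit q * mean p n χ := by
    rw [← smul_eq_mul, ← map_smul, ← map_add]
    congr 1
    ext z
    simp only [leaveIn, sideFn, Pi.add_apply, Pi.smul_apply, smul_eq_mul, hχ]
    split_ifs <;> simp only [Pi.zero_apply, Pi.one_apply] <;> ring
  have f2 : mean p n (leaveOut i) = mean p n (fun z => darkOut i z.lamps *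
      sideFn i (fun m => 1 - hit q ^ m) 0 z.pos) + mean p n ψ := by
    rw [← map_add]
    congr 1
    ext z
    simp only [leaveOut, sideFn, Pi.add_apply, hψ]
    split_ifs <;> simp only [Pi.zero_apply, Pi.one_apply] <;> ring
  have hF0 := hit_pos hq
  have hF1 := hit_lt_one hq
  have b1 : 0 ≤ mean p n χ := mean_nonneg hp0.le hp1.le n fun z => by
    refine mul_nonneg (darkIn_nonneg _ _) ?_
    rw [sideFn]
    split_ifs
    · exact le_rfl
    · positivity
  have b2 : 0 ≤ mean p n ψ := mean_nonneg hp0.le hp1.le n fun z => by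
    refine mul_nonneg (darkOut_nonneg _ _) ?_
    rw [sideFn]
    split_ifs
    · positivity
    · exact le_rfl
  have b3 : mean p n χ ≤ mean p n (hitRoot (q := q)) := mean_mono hp0.le hp1.le n fun z => by
    have h := hitRoot_nonneg hq z
    rw [hχ]
    simp only [sideFn]
    split_ifs
    · simpa using h
    · exact mul_le_of_le_one_left h (darkIn_le_one _ _)
  have b4 : mean p n ψ ≤ mean p n (hitRoot (q := q)) := mean_mono hp0.le hp1.le n fun z => by
    have h := hitRoot_nonneg hq z
    rw [hψ]
    simp only [sideFn]
    split_ifs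
    · exact mul_le_of_le_one_left h (darkOut_le_one _ _)
    · simpa using h
  -- With `c = (1-p)/q`, up to errors `leaveIn` is `(1-F)(1 + cA)` and `leaveOut` is `c(1-F)B`,
  -- while `e3` says `A ≈ F B`. Eliminating `A` leaves only the errors `χ` and `ψ`.
  have key : mean p n (leaveIn i) - mean p n (leaveOut i) -
      (1 - hit q) * (1 - mean p n (leaveOut i)) = hit q * mean p n χ - mean p n ψ := by
    rw [f1, f2, e1, e2]
    linear_combination (1 - hit q) * e3
  rw [key, abs_le]
  constructor <;> nlinarith

/-! ### Lower bound for the number of visits to the root with a dark complement. -/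

theorem stepR_nonneg {p : ℝ} (hp0 : 0 ≤ p) (hp1 : p ≤ 1) {f : Lamplighter q → ℝ}
    (hf : ∀ z, 0 ≤ f z) (z : Lamplighter q) : 0 ≤ stepR p f z := by
  have := stepR_pow_mono hp0 hp1 1 (f := 0) hf z
  rwa [pow_one, map_zero] at this

/-- All lamps off the branch at `a_i` are switched off, except possibly the one at the root. -/
def DarkAround (i : Fin q) (η : Tree q →₀ ZMod 2) : Prop :=
  ∀ w, w ≠ 1 → hd w ≠ some i → η w = 0

open Classical in
/-- The dependence on the lamps of the Green function of the walk that switches no lamp outside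
the branch at `a_i`, except at the root. -/
noncomputable def aroundFn (i : Fin q) (u₀ u₁ : ℝ) (η : Tree q →₀ ZMod 2) : ℝ :=
  if DarkAround i η then (if η 1 = 0 then u₀ else u₁) else 0

theorem aroundFn_nonneg (i : Fin q) {u₀ u₁ : ℝ} (h0 : 0 ≤ u₀) (h1 : 0 ≤ u₁)
    (η : Tree q →₀ ZMod 2) : 0 ≤ aroundFn i u₀ u₁ η := by
  rw [aroundFn]
  split_ifs <;> first | assumption | exact le_rfl

theorem aroundFn_le (i : Fin q) {u₀ u₁ : ℝ} (h1 : 0 ≤ u₁) (h : u₁ ≤ u₀)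
    (η : Tree q →₀ ZMod 2) : aroundFn i u₀ u₁ η ≤ u₀ := by
  rw [aroundFn]
  split_ifs
  · exact le_rfl
  · exact h
  · exact h1.trans h

theorem darkAround_mul_switch {i : Fin q} {z : Lamplighter q}
    (h : z.pos = 1 ∨ hd z.pos = some i) :
    DarkAround i (z * switch).lamps ↔ DarkAround i z.lamps := by
  refine forall_congr' fun w => forall_congr' fun hw1 => forall_congr' fun hw => ?_
  rw [mul_switch_lamps, if_neg, add_zero]
  rintro rfl
  exact h.elim hw1 hw

/-- Here `F^m` is the chance to return from the branch, where switches are free, and `b^m` the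
chance to reach the root from outside without any switch; `hb2` is its first-step equation. By `h0`
and `h1`, `u₀` and `u₁` count visits to the root with its lamp off, starting from the root with the
lamp off or on. There is only an inequality because other switches outside the branch are discarded.
-/
theorem sub_le_stepR_aroundFn (hq : 3 ≤ q) {p : ℝ} (hp0 : 0 ≤ p) (hp1 : p ≤ 1) (i : Fin q)
    {b u₀ u₁ : ℝ} (hb : 0 ≤ b) (hb2 : (1 - p) * (1 + (q - 1) * b ^ 2) = q * b)
    (hu0 : 0 ≤ u₀) (hu1 : 0 ≤ u₁)
    (h0 : u₀ = 1 + (1 - p) / q * (hit q + (q - 1) * b) * u₀ + p * u₁)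
    (h1 : u₁ = (1 - p) / q * (hit q + (q - 1) * b) * u₁ + p * u₀) (z : Lamplighter q) :
    aroundFn i u₀ u₁ z.lamps * sideFn i (fun m => hit q ^ m) (fun m => b ^ m) z.pos -
      darkOut i z.lamps * atVertex 1 z.pos ≤
    stepR p (fun z => aroundFn i u₀ u₁ z.lamps *
      sideFn i (fun m => hit q ^ m) (fun m => b ^ m) z.pos) z := by
  have hq3 := cast_ge_three hq
  have hside : ∀ x : Tree q, 0 ≤ sideFn i (fun m => hit q ^ m) (fun m => b ^ m) x := by
    intro x
    have := hit_pos hq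
    rw [sideFn]
    split_ifs <;> positivity
  have hat : 0 ≤ atVertex 1 z.pos := by rw [atVertex]; split_ifs <;> norm_num
  by_cases hD : DarkAround i z.lamps
  swap
  · have h2 := stepR_nonneg hp0 hp1 (fun z : Lamplighter q =>
      mul_nonneg (aroundFn_nonneg i hu0 hu1 z.lamps) (hside z.pos)) z
    have h3 := mul_nonneg (darkOut_nonneg i z.lamps) hat
    rw [aroundFn, if_neg hD]
    linarith
  rw [stepR_mul_apply p (aroundFn i u₀ u₁)]
  by_cases hx : z.pos = 1
  · have hsw : aroundFn i u₀ u₁ (z * switch).lamps = if z.lamps 1 = 0 then u₁ else u₀ := by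
      have key : ∀ a : ZMod 2, a + 1 = 0 ↔ ¬ a = 0 := by decide
      rw [aroundFn, if_pos ((darkAround_mul_switch (Or.inl hx)).mpr hD), mul_switch_lamps,
        if_pos hx.symm]
      simp only [key, ite_not]
    have hdo : DarkOut i z.lamps ↔ z.lamps 1 = 0 := by
      refine ⟨fun h => h 1 (by rw [hd_one]; simp), fun h w hw => ?_⟩
      by_cases hw1 : w = 1
      · rw [hw1, h]
      · exact hD w hw1 hw
    rw [hsw, hx, sideFn_one, sum_sideFn_one, atVertex, if_pos rfl, aroundFn, if_pos hD, darkOut,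
      propext hdo]
    split_ifs <;> linarith
  · rw [atVertex, if_neg hx, mul_zero, sub_zero]
    by_cases hh : hd z.pos = some i
    · have hsw : aroundFn i u₀ u₁ (z * switch).lamps = aroundFn i u₀ u₁ z.lamps := by
        have : (z * switch).lamps 1 = z.lamps 1 := by
          rw [mul_switch_lamps, if_neg (Ne.symm hx), add_zero]
        rw [aroundFn, aroundFn, propext (darkAround_mul_switch (Or.inr hh)), this]
      rw [hsw, step_average hq p]
      by_cases hxi : z.pos = letter i
      · rw [hxi, sum_sideFn_letter, sideFn_of_hd (hd_letter i), len_letter]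
        linear_combination aroundFn i u₀ u₁ z.lamps * (hit q - 1) * sub_one_mul_hit hq
      · obtain ⟨m, hm⟩ := exists_len_eq_succ hx
        rw [sum_sideFn_of_hd hh hxi hm, sideFn_of_hd hh, hm]
        linear_combination aroundFn i u₀ u₁ z.lamps * hit_pow_add hq m
    · obtain ⟨m, hm⟩ := exists_len_eq_succ hx
      -- The contribution of a switch at this vertex is nonnegative and is dropped; `h3` shows that
      -- the moves alone reproduce the value.
      have h2 := mul_nonneg hp0 (mul_nonneg
        (aroundFn_nonneg i hu0 hu1 (z * switch).lamps) (hside z.pos))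
      have h3 : (1 - p) / q * (aroundFn i u₀ u₁ z.lamps * (b ^ m + (q - 1) * b ^ (m + 2))) =
          aroundFn i u₀ u₁ z.lamps * b ^ (m + 1) := by
        field_simp
        linear_combination aroundFn i u₀ u₁ z.lamps * b ^ m * hb2
      rw [sum_sideFn_of_hd_ne hh hm, h3]
      rw [sideFn_of_hd_ne hh, hm] at h2 ⊢
      linarith

/-- The root is visited with dark complement at least `u₀ (1 - E F^|X_n|)` times on average, and
each visit is followed with probability `(1-p)/q · (1-F)` by a final departure into the branch. -/
theorem le_mean_leaveOut (hq : 3 ≤ q) {p : ℝ} (hp0 : 0 ≤ p) (hp1 : p ≤ 1) (i : Fin q)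
    {b u₀ u₁ : ℝ} (hb : 0 ≤ b) (hb1 : b ≤ hit q)
    (hb2 : (1 - p) * (1 + (q - 1) * b ^ 2) = q * b)
    (hu1 : 0 ≤ u₁) (hu : u₁ ≤ u₀)
    (h0 : u₀ = 1 + (1 - p) / q * (hit q + (q - 1) * b) * u₀ + p * u₁)
    (h1 : u₁ = (1 - p) / q * (hit q + (q - 1) * b) * u₁ + p * u₀) (n : ℕ) :
    (1 - p) / q * (1 - hit q) * u₀ * (1 - mean p n (hitRoot (q := q))) ≤
      mean p n (leaveOut i) := by
  have hF0 := hit_pos hq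
  have hF1 := hit_lt_one hq
  have hu0 : 0 ≤ u₀ := hu1.trans hu
  have hc : 0 ≤ (1 - p) / q * (1 - hit q) := by
    have h2 : 0 ≤ 1 - p := by linarith
    have h3 : 0 ≤ 1 - hit q := by linarith
    positivity
  have k1 := le_mean_of_le_stepR hp0 hp1
    (sub_le_stepR_aroundFn hq hp0 hp1 i hb hb2 hu0 hu1 h0 h1) n
  have hd1 : aroundFn i u₀ u₁ (0 : Tree q →₀ ZMod 2) = u₀ := by
    rw [aroundFn, if_pos (show DarkAround i 0 from fun w _ _ => rfl)]
    exact if_pos rfl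
  rw [one_lamps, Lamplighter.one_pos, sideFn_one, hd1, pow_zero, mul_one] at k1
  have k2 := mean_eq_of_stepR_eq (stepR_darkOut hq p i) n
  simp only [map_smul, smul_eq_mul, ← Finset.mul_sum, Lamplighter.one_pos, sideFn_one,
    Pi.zero_apply, mul_zero, zero_add] at k2
  have k3 : mean p n (fun z => darkOut i z.lamps * sideFn i (fun m => 1 - hit q ^ m) 0 z.pos) ≤
      mean p n (leaveOut i) := by
    refine mean_mono hp0 hp1 n fun z => mul_le_mul_of_nonneg_left ?_ (darkOut_nonneg _ _)
    rw [sideFn, sideFn]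
    split_ifs
    · have := pow_pos hF0 (len z.pos)
      simp only [Pi.one_apply]
      linarith
    · exact le_rfl
  have k4 : mean p n (fun z => aroundFn i u₀ u₁ z.lamps *
      sideFn i (fun m => hit q ^ m) (fun m => b ^ m) z.pos) ≤
      u₀ * mean p n (hitRoot (q := q)) := by
    rw [← smul_eq_mul, ← map_smul]
    refine mean_mono hp0 hp1 n fun z => mul_le_mul (aroundFn_le i hu1 hu _) ?_ ?_ hu0
    · rw [sideFn]
      split_ifs
      · exact le_rfl
      · exact pow_le_pow_left₀ hb hb1 _
    · rw [sideFn]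
      split_ifs <;> positivity
  refine le_trans ?_ k3
  rw [k2, mul_assoc]
  refine mul_le_mul_of_nonneg_left ?_ hc
  linarith

/-! ### The increments of the expected length -/

theorem sum_sideFn_one_zero (x : Tree q) :
    ∑ i, sideFn i 1 0 x = 1 - atVertex 1 x := by
  by_cases hx : x = 1
  · rw [atVertex, if_pos hx, sub_self]
    refine Finset.sum_eq_zero fun i _ => ?_
    rw [hx, sideFn_one]
    rfl
  · obtain ⟨k, hk⟩ := exists_hd hx
    rw [atVertex, if_neg hx, sub_zero, Finset.sum_eq_single k]
    · exact sideFn_of_hd hk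
    · intro j _ hj
      exact sideFn_of_hd_ne (by rw [hk]; simpa using hj.symm)
    · simp

/-- The position is in at most one branch, and the root belongs to the complement of every branch,
so its lamp must be off. -/
theorem sum_leaveOut_le (z : Lamplighter q) :
    ∑ i, leaveOut i z ≤ (1 + sgn (z.lamps 1)) / 2 := by
  by_cases h : z.lamps 1 = 0
  · rw [sgn, if_pos h]
    have h2 : ∑ i, leaveOut i z ≤ ∑ i, sideFn i 1 0 z.pos := by
      refine Finset.sum_le_sum fun i _ => mul_le_of_le_one_left ?_ (darkOut_le_one _ _)
      rw [sideFn]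
      split_ifs <;> simp
    rw [sum_sideFn_one_zero] at h2
    have : 0 ≤ atVertex 1 z.pos := by rw [atVertex]; split_ifs <;> norm_num
    linarith
  · rw [sgn, if_neg h, Finset.sum_eq_zero]
    · norm_num
    · intro i _
      rw [leaveOut, darkOut, if_neg, zero_mul]
      exact fun h2 => h (h2 1 (by rw [hd_one]; simp))

theorem tour_move_mul_eq (z : Lamplighter q) (i : Fin q) :
    ((move i * z).tour : ℝ) =
      z.tour + 2 * leaveIn i z - 2 * leaveOut i z - 1 + 2 * sideFn i 1 0 z.pos := by
  classical
  by_cases h : hd z.pos = some i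
  · have h1 := tour_move_mul_of_hd h
    rw [leaveIn, leaveOut, sideFn_of_hd h, sideFn_of_hd h, darkOut]
    simp only [Pi.zero_apply, Pi.one_apply]
    have h2 := congrArg (Nat.cast (R := ℝ)) h1
    push_cast at h2
    split_ifs at h2 ⊢ <;> linarith
  · have h1 := tour_move_mul h
    rw [leaveIn, leaveOut, sideFn_of_hd_ne h, sideFn_of_hd_ne h, darkIn]
    simp only [Pi.zero_apply, Pi.one_apply]
    have h2 := congrArg (Nat.cast (R := ℝ)) h1
    push_cast at h2
    split_ifs at h2 ⊢ <;> linarith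

theorem tour_switch_mul_eq (z : Lamplighter q) :
    ((switch * z).tour : ℝ) = z.tour + sgn (z.lamps 1) := by
  rw [sgn]
  split_ifs with h
  · rw [tour_switch_mul_of_off h]
    push_cast
    ring
  · rw [← tour_switch_mul_of_on h]
    push_cast
    ring

theorem mean_tour_succ_sub (hq : 3 ≤ q) (p : ℝ) (n : ℕ) :
    mean p (n + 1) (fun z : Lamplighter q => (z.tour : ℝ)) -
      mean p n (fun z : Lamplighter q => (z.tour : ℝ)) =
    p * mean p n (fun z : Lamplighter q => sgn (z.lamps 1)) +
      (1 - p) / q * (2 * ∑ i, (mean p n (leaveIn i) - mean p n (leaveOut (q := q) i)) - q + 2 -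
        2 * mean p n (fun z : Lamplighter q => atVertex 1 z.pos)) := by
  have hq3 := cast_ge_three hq
  have h : stepL p (fun z : Lamplighter q => (z.tour : ℝ)) =
      (fun z : Lamplighter q => (z.tour : ℝ)) + (p • (fun z : Lamplighter q => sgn (z.lamps 1)) +
      ((1 - p) / q) • ((2 : ℝ) • ∑ i, (leaveIn i - leaveOut i) + (fun _ => 2 - (q : ℝ)) -
        (2 : ℝ) • fun z : Lamplighter q => atVertex 1 z.pos)) := by
    ext z
    simp only [stepL_apply, tour_move_mul_eq, tour_switch_mul_eq, Pi.add_apply, Pi.smul_apply,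
      Pi.sub_apply, Finset.sum_apply, smul_eq_mul, Finset.sum_add_distrib,
      Finset.sum_sub_distrib, ← Finset.mul_sum, sum_sideFn_one_zero, Finset.sum_const,
      Finset.card_univ, Fintype.card_fin, nsmul_eq_mul]
    field_simp
    ring
  rw [mean_succ_left, h]
  simp only [map_add, map_sub, map_smul, map_sum, smul_eq_mul, mean_const (show q ≠ 0 by omega)]
  ring

theorem mean_atVertex_one_mem (hq : 3 ≤ q) {p : ℝ} (hp0 : 0 ≤ p) (hp1 : p ≤ 1) (n : ℕ) :
    0 ≤ mean p n (fun z : Lamplighter q => atVertex 1 z.pos) ∧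
      mean p n (fun z : Lamplighter q => atVertex 1 z.pos) ≤ mean p n (hitRoot (q := q)) := by
  constructor
  · refine mean_nonneg hp0 hp1 n fun z => ?_
    rw [atVertex]
    split_ifs <;> norm_num
  · refine mean_mono hp0 hp1 n fun z => ?_
    rw [atVertex]
    split_ifs with h
    · rw [hitRoot, h, len_one, pow_zero]
    · exact hitRoot_nonneg hq z

/-- The right side is the limiting drift in `mean_tour_succ_sub` when every `leaveOut i` has
probability `ν`. -/
theorem ellOfNu_eq (hq : 3 ≤ q) {p : ℝ} (hp0 : 0 < p) (ν : ℝ) :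
    ellOfNu q p ν = p * (1 - lit q p) +
      (1 - p) / q * (2 * (q * ((1 - hit q) * (1 - ν))) - q + 2) := by
  have hq3 := cast_ge_three hq
  have hd : p * q + q - 2 ≠ 0 := by nlinarith
  have hd1 : (q : ℝ) - 1 ≠ 0 := by linarith
  have hd2 : (q : ℝ) ≠ 0 := by linarith
  rw [ellOfNu, lit, hit]
  generalize hD : p * q + q - 2 = D at *
  field_simp
  rw [← hD]
  ring

/-- The right side is the limiting drift when the probabilities of the events `leaveOut i` add up to
their upper bound `1 - lit/2`. -/
theorem ellLow_eq (hq : 3 ≤ q) {p : ℝ} (hp0 : 0 < p) :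
    ellLow q p = p * (1 - lit q p) +
      (1 - p) / q * (2 * ((1 - hit q) * (q - (1 - lit q p / 2))) - q + 2) := by
  have hq3 := cast_ge_three hq
  have hd : p * q + q - 2 ≠ 0 := by nlinarith
  have hd1 : (q : ℝ) - 1 ≠ 0 := by linarith
  have hd2 : (q : ℝ) ≠ 0 := by linarith
  rw [ellLow, lit, hit]
  generalize hD : p * q + q - 2 = D at *
  field_simp
  rw [← hD]
  ring

theorem mean_tour_succ_sub_le (hq : 3 ≤ q) {p : ℝ} (hp0 : 0 < p) (hp1 : p < 1) {ν : ℝ} (n : ℕ)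
    (hν : ∀ i : Fin q, ν * (1 - mean p n (hitRoot (q := q))) ≤ mean p n (leaveOut i)) :
    mean p (n + 1) (fun z : Lamplighter q => (z.tour : ℝ)) -
      mean p n (fun z : Lamplighter q => (z.tour : ℝ)) ≤
    ellOfNu q p ν + (p + 2 * (1 - p) * ((1 - hit q) * ν + 1)) * mean p n (hitRoot (q := q)) := by
  have hq3 := cast_ge_three hq
  have hF1 := hit_lt_one hq
  set ε := mean p n (hitRoot (q := q))
  have h1 := (abs_le.mp (abs_mean_sgn_sub_le hq hp0 hp1 n)).2
  have h2 : ∑ i, (mean p n (leaveIn i) - mean p n (leaveOut (q := q) i)) ≤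
      q * ((1 - hit q) * (1 - ν + ν * ε) + ε) := by
    have : ∀ i : Fin q, mean p n (leaveIn i) - mean p n (leaveOut i) ≤
        (1 - hit q) * (1 - ν + ν * ε) + ε := fun i => by
      have h3 := (abs_le.mp (abs_mean_leave_sub_le hq hp0 hp1 n i)).2
      have h4 : (1 - hit q) * (1 - mean p n (leaveOut i)) ≤ (1 - hit q) * (1 - ν + ν * ε) :=
        mul_le_mul_of_nonneg_left (by linarith [hν i]) (by linarith)
      linarith
    refine (Finset.sum_le_sum fun i _ => this i).trans_eq ?_
    rw [Finset.sum_const, Finset.card_univ, Fintype.card_fin, nsmul_eq_mul]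
  have h3 := (mean_atVertex_one_mem hq hp0.le hp1.le n).1
  rw [mean_tour_succ_sub hq, ellOfNu_eq hq hp0]
  have h4 : p * mean p n (fun z : Lamplighter q => sgn (z.lamps 1)) ≤ p * (1 - lit q p + ε) :=
    mul_le_mul_of_nonneg_left (by linarith) hp0.le
  have h5 : (1 - p) / q * (2 * ∑ i, (mean p n (leaveIn i) - mean p n (leaveOut (q := q) i)) - q +
      2 - 2 * mean p n (fun z : Lamplighter q => atVertex 1 z.pos)) ≤
      (1 - p) / q * (2 * (q * ((1 - hit q) * (1 - ν + ν * ε) + ε)) - q + 2) :=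
    mul_le_mul_of_nonneg_left (by linarith) (div_nonneg (by linarith) (by linarith))
  refine (add_le_add h4 h5).trans_eq ?_
  field_simp
  ring

theorem le_mean_tour_succ_sub (hq : 3 ≤ q) {p : ℝ} (hp0 : 0 < p) (hp1 : p < 1) (n : ℕ) :
    ellLow q p - (p + (1 - p) / q * ((1 - hit q) + 2 * q + 2)) * mean p n (hitRoot (q := q)) ≤
    mean p (n + 1) (fun z : Lamplighter q => (z.tour : ℝ)) -
      mean p n (fun z : Lamplighter q => (z.tour : ℝ)) := by
  have hq3 := cast_ge_three hq
  have hF1 := hit_lt_one hq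
  set ε := mean p n (hitRoot (q := q))
  obtain ⟨h1, h1'⟩ := abs_le.mp (abs_mean_sgn_sub_le hq hp0 hp1 n)
  have hsum : ∑ i, mean p n (leaveOut (q := q) i) ≤ 1 - lit q p / 2 + ε / 2 := by
    rw [← map_sum]
    have h2 := mean_mono hp0.le hp1.le n (f := ∑ i, leaveOut (q := q) i)
      (g := fun z => (1 + sgn (z.lamps 1)) / 2) fun z => by
        rw [Finset.sum_apply]
        exact sum_leaveOut_le z
    have h3 : (fun z : Lamplighter q => (1 + sgn (z.lamps 1)) / 2) =
        (1 / 2 : ℝ) • ((fun _ => 1) + fun z : Lamplighter q => sgn (z.lamps 1)) := by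
      ext z
      simp only [Pi.smul_apply, Pi.add_apply, smul_eq_mul]
      ring
    rw [h3, map_smul, map_add, mean_const (show q ≠ 0 by omega), smul_eq_mul] at h2
    linarith
  have h2 : (1 - hit q) * (q - (1 - lit q p / 2 + ε / 2)) - q * ε ≤
      ∑ i, (mean p n (leaveIn i) - mean p n (leaveOut (q := q) i)) := by
    have h3 : ∀ i : Fin q, (1 - hit q) * (1 - mean p n (leaveOut i)) - ε ≤
        mean p n (leaveIn i) - mean p n (leaveOut i) := fun i => by
      have := (abs_le.mp (abs_mean_leave_sub_le hq hp0 hp1 n i)).1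
      linarith
    refine le_trans ?_ (Finset.sum_le_sum fun i _ => h3 i)
    rw [Finset.sum_sub_distrib, ← Finset.mul_sum, Finset.sum_sub_distrib, Finset.sum_const,
      Finset.sum_const, Finset.card_univ, Fintype.card_fin, nsmul_eq_mul, nsmul_eq_mul, mul_one]
    have := mul_le_mul_of_nonneg_left hsum (show 0 ≤ 1 - hit q by linarith)
    linarith
  have h3 := (mean_atVertex_one_mem hq hp0.le hp1.le n).2
  rw [mean_tour_succ_sub hq, ellLow_eq hq hp0]
  have h4 : p * (1 - lit q p - ε) ≤ p * mean p n (fun z : Lamplighter q => sgn (z.lamps 1)) :=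
    mul_le_mul_of_nonneg_left (by linarith) hp0.le
  have h5 : (1 - p) / q * (2 * ((1 - hit q) * (q - (1 - lit q p / 2 + ε / 2)) - q * ε) - q + 2 -
      2 * ε) ≤ (1 - p) / q * (2 * ∑ i, (mean p n (leaveIn i) - mean p n (leaveOut (q := q) i)) -
      q + 2 - 2 * mean p n (fun z : Lamplighter q => atVertex 1 z.pos)) :=
    mul_le_mul_of_nonneg_left (by linarith) (div_nonneg (by linarith) (by linarith))
  refine le_trans (le_of_eq ?_) (add_le_add h4 h5)
  ring

theorem mean_len_succ_sub (hq : 3 ≤ q) (p : ℝ) (n : ℕ) :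
    mean p (n + 1) (fun z : Lamplighter q => (len z.pos : ℝ)) -
      mean p n (fun z : Lamplighter q => (len z.pos : ℝ)) =
    treeSpeed q p + 2 * (1 - p) / q * mean p n (fun z : Lamplighter q => atVertex 1 z.pos) := by
  have hq3 := cast_ge_three hq
  have h : stepR p (fun z : Lamplighter q => (len z.pos : ℝ)) =
      (fun z : Lamplighter q => (len z.pos : ℝ)) + ((fun _ => treeSpeed q p) +
        (2 * (1 - p) / q) • fun z : Lamplighter q => atVertex 1 z.pos) := by
    ext z
    simp only [stepR_apply, mul_switch_pos, mul_move_pos, Pi.add_apply, Pi.smul_apply,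
      smul_eq_mul, treeSpeed]
    by_cases hz : z.pos = 1
    · rw [hz, sum_radial_one (fun m => (m : ℝ)), atVertex, if_pos rfl, len_one]
      push_cast
      field_simp
      ring
    · obtain ⟨m, hm⟩ := exists_len_eq_succ hz
      rw [sum_len_mul_letter (fun m => (m : ℝ)) hm, atVertex, if_neg hz, hm]
      push_cast
      field_simp
      ring
  rw [mean_succ, h, map_add, map_add, map_smul, mean_const (show q ≠ 0 by omega), smul_eq_mul]
  ring

/-! ### Cesàro limits -/

theorem limit_le_of_increments_le {a c : ℕ → ℝ} {B ℓ : ℝ} (h : ∀ n, a (n + 1) - a n ≤ B + c n)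
    (hc : Tendsto c atTop (𝓝 0)) (ha : Tendsto (fun n => a n / n) atTop (𝓝 ℓ)) : ℓ ≤ B := by
  have h1 : ∀ n : ℕ, a n ≤ a 0 + n * B + ∑ k ∈ Finset.range n, c k := by
    intro n
    induction n with
    | zero => simp
    | succ n ih =>
      rw [Finset.sum_range_succ]
      push_cast
      linarith [h n]
  have h2 : Tendsto (fun n : ℕ => a 0 / n + B + (n : ℝ)⁻¹ * ∑ k ∈ Finset.range n, c k) atTop
      (𝓝 (0 + B + 0)) :=
    ((tendsto_const_div_atTop_nhds_zero_nat (a 0)).add_const B).add hc.cesaro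
  rw [zero_add, add_zero] at h2
  refine le_of_tendsto_of_tendsto ha h2 ?_
  filter_upwards [eventually_gt_atTop 0] with n hn
  have hn' : (0 : ℝ) < n := by exact_mod_cast hn
  rw [div_le_iff₀ hn']
  refine (h1 n).trans_eq ?_
  field_simp

theorem le_limit_of_le_increments {a c : ℕ → ℝ} {B ℓ : ℝ} (h : ∀ n, B - c n ≤ a (n + 1) - a n)
    (hc : Tendsto c atTop (𝓝 0)) (ha : Tendsto (fun n => a n / n) atTop (𝓝 ℓ)) : B ≤ ℓ := by
  have := limit_le_of_increments_le (a := fun n => -a n) (B := -B) (c := c) (ℓ := -ℓ)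
    (fun n => by linarith [h n]) hc (by simpa only [neg_div] using ha.neg)
  linarith

/-! ### The constants -/

theorem sqrt_disc_sq (hq : 3 ≤ q) {p : ℝ} (hp0 : 0 < p) (hp1 : p < 1) :
    √((q : ℝ) ^ 2 - 4 * (q - 1) * (1 - p) ^ 2) ^ 2 = (q : ℝ) ^ 2 - 4 * (q - 1) * (1 - p) ^ 2 := by
  have hq3 := cast_ge_three hq
  refine Real.sq_sqrt ?_
  nlinarith [sq_nonneg ((q : ℝ) - 2), mul_nonneg (show (0 : ℝ) ≤ q - 1 by linarith)
    (show 0 ≤ 1 - (1 - p) ^ 2 by nlinarith)]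

/-- First-step equation: the first increment must be a move, which either reaches the target or
leads to a vertex from which two such passages are needed. -/
theorem hitBar_quadratic (hq : 3 ≤ q) {p : ℝ} (hp0 : 0 < p) (hp1 : p < 1) :
    (1 - p) * (1 + (q - 1) * hitBar q p ^ 2) = q * hitBar q p := by
  have hq3 := cast_ge_three hq
  have hd1 : (q : ℝ) - 1 ≠ 0 := by linarith
  have hd2 : 1 - p ≠ 0 := by linarith
  have h := sqrt_disc_sq hq hp0 hp1
  rw [hitBar]
  set S := √((q : ℝ) ^ 2 - 4 * (q - 1) * (1 - p) ^ 2)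
  field_simp
  linear_combination h

theorem hitBar_nonneg (hq : 3 ≤ q) {p : ℝ} (hp1 : p < 1) : 0 ≤ hitBar q p := by
  have hq3 := cast_ge_three hq
  have h1 : (0 : ℝ) < q - 1 := by linarith
  have h2 : 0 < 1 - p := by linarith
  refine div_nonneg (sub_nonneg.mpr (Real.sqrt_le_iff.mpr ⟨by linarith, ?_⟩)) (by positivity)
  have : 0 ≤ 4 * ((q : ℝ) - 1) * (1 - p) ^ 2 := by positivity
  linarith

theorem hitBar_le_hit (hq : 3 ≤ q) {p : ℝ} (hp0 : 0 < p) (hp1 : p < 1) :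
    hitBar q p ≤ hit q := by
  have hq3 := cast_ge_three hq
  have h1 : (0 : ℝ) < q - 1 := by linarith
  have h2 : 0 < 1 - p := by linarith
  have h3 : (q : ℝ) - 2 * (1 - p) ≤ √((q : ℝ) ^ 2 - 4 * (q - 1) * (1 - p) ^ 2) := by
    refine Real.le_sqrt_of_sq_le ?_
    nlinarith [mul_pos (mul_pos (show (0 : ℝ) < q by linarith) h2) hp0]
  rw [hitBar, hit, div_le_div_iff₀ (by positivity) h1]
  nlinarith [mul_le_mul_of_nonneg_left h3 h1.le]

/-- The return probability `Û`. -/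
noncomputable def returnHat (q : ℕ) (p : ℝ) : ℝ := (1 - p) / q * (hit q + (q - 1) * hitBar q p)

theorem greenHatSharp_eq (q : ℕ) (p : ℝ) : greenHatSharp q p = 1 / (1 - returnHat q p) := by
  rw [greenHatSharp, returnHat, hit]
  congr 2
  ring

theorem greenHat_eq (hq : 3 ≤ q) {p : ℝ} (hp1 : p < 1) :
    greenHat q p = 1 / (1 - (1 - p) * hitBar q p) := by
  have hq3 := cast_ge_three hq
  have h1 : (q : ℝ) - 1 ≠ 0 := by linarith
  have h2 : 1 - p ≠ 0 := by linarith
  have h3 : 1 - (1 - p) * hitBar q p =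
      (q - 2 + √((q : ℝ) ^ 2 - 4 * (q - 1) * (1 - p) ^ 2)) / (2 * (q - 1)) := by
    rw [hitBar]
    field_simp
    ring
  rw [h3, greenHat, one_div_div]

theorem returnHat_nonneg (hq : 3 ≤ q) {p : ℝ} (hp1 : p < 1) : 0 ≤ returnHat q p := by
  have hq3 := cast_ge_three hq
  have h1 : (0 : ℝ) ≤ q - 1 := by linarith
  have h2 : 0 ≤ 1 - p := by linarith
  have h3 := hitBar_nonneg hq hp1
  have h4 := hit_pos hq
  rw [returnHat]
  positivity

/-- Since `F̄ ≤ F`, one has `Û ≤ (1-p) F < 1 - p`. This gives `p G < 1`, so the denominator of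
`nuHat` is positive. -/
theorem returnHat_add_lt_one (hq : 3 ≤ q) {p : ℝ} (hp0 : 0 < p) (hp1 : p < 1) :
    returnHat q p + p < 1 := by
  have hq3 := cast_ge_three hq
  have h1 : (0 : ℝ) ≤ q - 1 := by linarith
  have h2 : 0 < 1 - p := by linarith
  have h3 := hitBar_le_hit hq hp0 hp1
  have h4 : returnHat q p ≤ (1 - p) / q * (hit q + (q - 1) * hit q) := by
    rw [returnHat]
    gcongr
  have h5 : (1 - p) / q * (hit q + (q - 1) * hit q) = (1 - p) * hit q := by
    field_simp
    ring
  nlinarith [hit_lt_one hq]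

/-- Forbidding switches in the branch at `a_i` as well replaces one `F` among the `q` returns by
`F̄`; this is the step from `1/(1 - Û)` to `Ĝ`. -/
theorem mul_hitBar_le_returnHat (hq : 3 ≤ q) {p : ℝ} (hp0 : 0 < p) (hp1 : p < 1) :
    (1 - p) * hitBar q p ≤ returnHat q p := by
  have hq3 := cast_ge_three hq
  have h2 : 0 ≤ 1 - p := by linarith
  have h3 := hitBar_le_hit hq hp0 hp1
  have h4 : (1 - p) * hitBar q p = (1 - p) / q * (hitBar q p + (q - 1) * hitBar q p) := by
    field_simp
    ring
  rw [h4, returnHat]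
  gcongr

theorem nuHat_mono (hq : 3 ≤ q) {p G H : ℝ} (hp0 : 0 < p) (hp1 : p < 1) (hG : 0 ≤ G)
    (hGH : G ≤ H) (hH : H * p < 1) : nuHat q p G ≤ nuHat q p H := by
  have hq3 := cast_ge_three hq
  have h1 : (0 : ℝ) ≤ q - 1 := by linarith
  have h2 : 0 ≤ 1 - p := by linarith
  have h3 : (0 : ℝ) ≤ q - 2 := by linarith
  have hH0 : 0 ≤ H * p := mul_nonneg (hG.trans hGH) hp0.le
  have hH1 : 0 ≤ H := hG.trans hGH
  have h4 : 0 < 1 - H ^ 2 * p ^ 2 := by nlinarith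
  rw [nuHat, nuHat]
  gcongr

theorem ellOfNu_anti (hq : 3 ≤ q) {p μ ν : ℝ} (hp1 : p < 1) (h : μ ≤ ν) :
    ellOfNu q p ν ≤ ellOfNu q p μ := by
  have hq3 := cast_ge_three hq
  have h1 : (0 : ℝ) ≤ q - 1 := by linarith
  have h2 : 0 ≤ 1 - p := by linarith
  have h3 : (0 : ℝ) ≤ q - 2 := by linarith
  rw [ellOfNu, ellOfNu]
  gcongr

theorem treeSpeed_lt_ellLow (hq : 3 ≤ q) {p : ℝ} (hp0 : 0 < p) (hp1 : p < 1) :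
    treeSpeed q p < ellLow q p := by
  have hq3 := cast_ge_three hq
  have h1 : (0 : ℝ) < (1 - p) * (q - 2) / q :=
    div_pos (mul_pos (by linarith) (by linarith)) (by linarith)
  refine lt_mul_of_one_lt_right h1 ?_
  rw [one_lt_div (by nlinarith)]
  nlinarith

/-! ### The rates of escape of the expectations -/

theorem exists_tendsto_mean_div (hq : q ≠ 0) {p : ℝ} (hp0 : 0 ≤ p) (hp1 : p ≤ 1)
    {f : Lamplighter q → ℝ} (hf0 : ∀ z, 0 ≤ f z) (hf : ∀ z w, f (z * w) ≤ f z + f w) :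
    ∃ ℓ, Tendsto (fun n : ℕ => mean p n f / n) atTop (𝓝 ℓ) := by
  have hsub : Subadditive fun n => mean p n f := fun m n => mean_add_le hq hp0 hp1 hf m n
  refine ⟨hsub.lim, hsub.tendsto_lim ⟨0, ?_⟩⟩
  rintro _ ⟨n, rfl⟩
  exact div_nonneg (mean_nonneg hp0 hp1 n hf0) (Nat.cast_nonneg n)

theorem eq_treeSpeed_of_tendsto (hq : 3 ≤ q) {p : ℝ} (hp0 : 0 < p) (hp1 : p < 1) {ℓ : ℝ}
    (h : Tendsto (fun n : ℕ => mean p n (fun z : Lamplighter q => (len z.pos : ℝ)) / n) atTop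
      (𝓝 ℓ)) : ℓ = treeSpeed q p := by
  have hq3 := cast_ge_three hq
  have hc := (tendsto_mean_hitRoot hq hp0 hp1).const_mul (2 * (1 - p) / q)
  rw [mul_zero] at hc
  have h0 : 0 ≤ 2 * (1 - p) / q := div_nonneg (by linarith) (by linarith)
  refine le_antisymm (limit_le_of_increments_le (fun n => ?_) hc h)
    (le_limit_of_le_increments (fun n => ?_) hc h)
  · rw [mean_len_succ_sub hq]
    have := mul_le_mul_of_nonneg_left (mean_atVertex_one_mem hq hp0.le hp1.le n).2 h0
    linarith
  · rw [mean_len_succ_sub hq]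
    have h1 := mul_nonneg h0 (mean_atVertex_one_mem hq hp0.le hp1.le n).1
    have h2 := mul_nonneg h0 (mean_nonneg hp0.le hp1.le n (hitRoot_nonneg hq))
    linarith

theorem ellLow_le_of_tendsto (hq : 3 ≤ q) {p : ℝ} (hp0 : 0 < p) (hp1 : p < 1) {ℓ : ℝ}
    (h : Tendsto (fun n : ℕ => mean p n (fun z : Lamplighter q => (z.tour : ℝ)) / n) atTop
      (𝓝 ℓ)) : ellLow q p ≤ ℓ := by
  have hc := (tendsto_mean_hitRoot hq hp0 hp1).const_mul
    (p + (1 - p) / q * ((1 - hit q) + 2 * q + 2))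
  rw [mul_zero] at hc
  exact le_limit_of_le_increments (fun n => le_mean_tour_succ_sub hq hp0 hp1 n) hc h

theorem nuHat_greenHatSharp_le (hq : 3 ≤ q) {p : ℝ} (hp0 : 0 < p) (hp1 : p < 1) (n : ℕ)
    (i : Fin q) : nuHat q p (greenHatSharp q p) * (1 - mean p n (hitRoot (q := q))) ≤
      mean p n (leaveOut i) := by
  have hq3 := cast_ge_three hq
  have hU0 := returnHat_nonneg hq hp1
  have hU1 := returnHat_add_lt_one hq hp0 hp1
  have hG := greenHatSharp_eq q p
  set U := returnHat q p with hU
  set G := greenHatSharp q p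
  have hne : 1 - U ≠ 0 := by linarith
  have hG0 : 0 < G := by
    rw [hG]
    exact one_div_pos.mpr (by linarith)
  have hGU : G * (1 - U) = 1 := by rw [hG, one_div_mul_cancel hne]
  have hGp : p * G ≤ 1 := by
    rw [hG, mul_one_div, div_le_one (by linarith)]
    linarith
  have hGp1 : p * G < 1 := by
    rw [hG, mul_one_div, div_lt_one (by linarith)]
    linarith
  have hD : 0 < 1 - G ^ 2 * p ^ 2 := by nlinarith [mul_pos hp0 hG0]
  -- The values `u₀ = u` and `u₁ = p G u` solve the linear system of `le_mean_leaveOut`.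
  set u : ℝ := G / (1 - G ^ 2 * p ^ 2) with hu
  have hu0 : 0 < u := div_pos hG0 hD
  have huD : u * (1 - G ^ 2 * p ^ 2) = G := div_mul_cancel₀ _ hD.ne'
  have key : u * (1 - U - p ^ 2 * G) = 1 := by
    have : G * (u * (1 - U - p ^ 2 * G)) = G * 1 := by linear_combination u * hGU + huD
    exact mul_left_cancel₀ hG0.ne' this
  have h := le_mean_leaveOut hq hp0.le hp1.le i (hitBar_nonneg hq hp1)
    (hitBar_le_hit hq hp0 hp1) (hitBar_quadratic hq hp0 hp1) (u₀ := u) (u₁ := p * G * u)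
    (by positivity) (mul_le_of_le_one_left hu0.le hGp)
    (by
      change u = 1 + U * u + p * (p * G * u)
      linear_combination key)
    (by
      change p * G * u = U * (p * G * u) + p * u
      linear_combination p * u * hGU) n
  refine le_trans (le_of_eq ?_) h
  congr 1
  rw [nuHat, ← hu, hit]
  have hd1 : (q : ℝ) - 1 ≠ 0 := by linarith
  field_simp
  ring

theorem le_ellOfNu_sharp_of_tendsto (hq : 3 ≤ q) {p : ℝ} (hp0 : 0 < p) (hp1 : p < 1) {ℓ : ℝ}
    (h : Tendsto (fun n : ℕ => mean p n (fun z : Lamplighter q => (z.tour : ℝ)) / n) atTop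
      (𝓝 ℓ)) : ℓ ≤ ellOfNu q p (nuHat q p (greenHatSharp q p)) := by
  have hc := (tendsto_mean_hitRoot hq hp0 hp1).const_mul
    (p + 2 * (1 - p) * ((1 - hit q) * nuHat q p (greenHatSharp q p) + 1))
  rw [mul_zero] at hc
  exact limit_le_of_increments_le (fun n => mean_tour_succ_sub_le hq hp0 hp1 n fun i =>
    nuHat_greenHatSharp_le hq hp0 hp1 n i) hc h

theorem ellOfNu_sharp_le (hq : 3 ≤ q) {p : ℝ} (hp0 : 0 < p) (hp1 : p < 1) :
    ellOfNu q p (nuHat q p (greenHatSharp q p)) ≤ ellOfNu q p (nuHat q p (greenHat q p)) := by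
  have hU1 := returnHat_add_lt_one hq hp0 hp1
  have h1 := mul_hitBar_le_returnHat hq hp0 hp1
  rw [greenHatSharp_eq, greenHat_eq hq hp1]
  refine ellOfNu_anti hq hp1 (nuHat_mono hq hp0 hp1 ?_ ?_ ?_)
  · exact one_div_nonneg.mpr (by linarith)
  · exact one_div_le_one_div_of_le (by linarith) (by linarith)
  · rw [one_div_mul_eq_div, div_lt_one (by linarith)]
    linarith

theorem lamplighter_injective :
    Function.Injective fun z : Lamplighter q => (z.lamps, z.pos) := fun z w h => by
  rw [Prod.mk.injEq] at h
  exact Lamplighter.ext h.1 h.2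

instance : Countable (Lamplighter q) := lamplighter_injective.countable

/-! ### Products of sequences of increments -/

/-- The product of the first `n` entries of a sequence of increments. -/
noncomputable def pathProd (x : ℕ → Lamplighter q) : ℕ → Lamplighter q
  | 0 => 1
  | n + 1 => pathProd x n * x n

/-- Forget the first `k` entries of a sequence. -/
def dropSeq (k : ℕ) (x : ℕ → Lamplighter q) : ℕ → Lamplighter q := fun j => x (k + j)

theorem walk_eq_pathProd {Ω : Type*} (ξ : ℕ → Ω → Lamplighter q) (n : ℕ) (ω : Ω) :
    walk ξ n ω = pathProd (fun k => ξ k ω) n := by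
  induction n with
  | zero => rfl
  | succ n ih => rw [walk, pathProd, ih]

theorem pathProd_add (x : ℕ → Lamplighter q) (m n : ℕ) :
    pathProd x (m + n) = pathProd x m * pathProd (dropSeq m x) n := by
  induction n with
  | zero => rw [add_zero, pathProd, mul_one]
  | succ n ih => rw [← add_assoc, pathProd, pathProd, ih, mul_assoc, dropSeq]

theorem dropSeq_dropSeq (k l : ℕ) (x : ℕ → Lamplighter q) :
    dropSeq l (dropSeq k x) = dropSeq (k + l) x := by
  ext1 j
  simp only [dropSeq, add_assoc]

theorem pathProd_congr {x y : ℕ → Lamplighter q} {n : ℕ} (h : ∀ j < n, x j = y j) :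
    pathProd x n = pathProd y n := by
  induction n with
  | zero => rfl
  | succ n ih => rw [pathProd, pathProd, ih fun j hj => h j (by omega), h n (by omega)]

theorem measurable_pathProd (n : ℕ) :
    Measurable fun x : ℕ → Lamplighter q => pathProd x n := by
  induction n with
  | zero => exact measurable_const
  | succ n ih =>
    have hmul : Measurable fun s : Lamplighter q × Lamplighter q => s.1 * s.2 :=
      Measurable.of_discrete
    have hn : Measurable fun x : ℕ → Lamplighter q => x n := measurable_pi_apply n
    have h := hmul.comp (ih.prodMk hn)
    simpa only [Function.comp_def] using! h

theorem measurable_dropSeq (k : ℕ) : Measurable (dropSeq (q := q) k) :=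
  measurable_pi_lambda _ fun j => measurable_pi_apply (k + j)

/-! ### Sequences of independent increments -/

/-- The generators of the lamplighter group. -/
def gens (q : ℕ) : Set (Lamplighter q) := insert switch (Set.range move)

theorem gens_finite : (gens q).Finite := (Set.finite_range _).insert _

theorem stepLaw_compl_gens (p : ℝ) : stepLaw q p (gens q)ᶜ = 0 := by
  simp [stepLaw, gens]

theorem integral_stepLaw {p : ℝ} (hp0 : 0 ≤ p) (hp1 : p ≤ 1) (f : Lamplighter q → ℝ)
    (z : Lamplighter q) : ∫ s, f (z * s) ∂(stepLaw q p) = stepR p f z := by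
  have hint : ∀ (c : ℝ) (a : Lamplighter q),
      Integrable (fun s => f (z * s)) (ENNReal.ofReal c • Measure.dirac a) := fun c a =>
    (integrable_dirac (by finiteness)).smul_measure ENNReal.ofReal_ne_top
  rw [stepLaw, integral_add_measure (hint _ _) (integrable_finsetSum_measure.mpr fun i _ =>
    hint _ _), integral_finsetSum_measure fun i _ => hint _ _]
  have h : 0 ≤ (1 - p) / q := div_nonneg (by linarith) (Nat.cast_nonneg q)
  simp only [integral_smul_measure, integral_dirac, ENNReal.toReal_ofReal hp0,
    ENNReal.toReal_ofReal h, smul_eq_mul, stepR_apply, Finset.mul_sum]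

section Increments

variable {Ω : Type*} [MeasurableSpace Ω] {P : Measure Ω}
  {ξ : ℕ → Ω → Lamplighter q} {p : ℝ}

theorem ae_mem_gens (hmeas : ∀ k, Measurable (ξ k)) (hlaw : ∀ k, P.map (ξ k) = stepLaw q p) :
    ∀ᵐ ω ∂P, ∀ k, ξ k ω ∈ gens q := by
  refine ae_all_iff.mpr fun k => ae_of_ae_map (hmeas k).aemeasurable ?_
  rw [hlaw]
  exact stepLaw_compl_gens p

theorem ae_pathProd_mem (hmeas : ∀ k, Measurable (ξ k))
    (hlaw : ∀ k, P.map (ξ k) = stepLaw q p) (n : ℕ) :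
    ∃ S : Set (Lamplighter q), S.Finite ∧ ∀ᵐ ω ∂P, pathProd (fun k => ξ k ω) n ∈ S := by
  induction n with
  | zero => exact ⟨{1}, Set.finite_singleton 1, Eventually.of_forall fun ω => rfl⟩
  | succ n ih =>
    obtain ⟨S, hS, h⟩ := ih
    refine ⟨Set.image2 (· * ·) S (gens q), hS.image2 _ gens_finite, ?_⟩
    filter_upwards [h, ae_mem_gens hmeas hlaw] with ω h1 h2
    exact Set.mem_image2_of_mem h1 (h2 n)

theorem measurable_increments (hmeas : ∀ k, Measurable (ξ k)) :
    Measurable fun ω k => ξ k ω := measurable_pi_lambda _ hmeas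

theorem indepFun_pathProd (hmeas : ∀ k, Measurable (ξ k)) (hindep : iIndepFun ξ P) (n : ℕ) :
    IndepFun (fun ω => pathProd (fun k => ξ k ω) n) (ξ n) P := by
  have h := hindep.indepFun_finset (Finset.range n) {n} (by simp) hmeas
  set ext : (Finset.range n → Lamplighter q) → ℕ → Lamplighter q :=
    fun y j => if h : j ∈ Finset.range n then y ⟨j, h⟩ else 1 with hext
  have hm : Measurable ext := by
    refine measurable_pi_lambda _ fun j => ?_
    by_cases hj : j ∈ Finset.range n
    · simp only [hext, dif_pos hj]
      exact measurable_pi_apply _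
    · simp only [hext, dif_neg hj]
      exact measurable_const
  have h2 := h.comp ((measurable_pathProd n).comp hm)
    (measurable_pi_apply (⟨n, Finset.mem_singleton_self n⟩ : ({n} : Finset ℕ)))
  convert! h2 using 1
  ext1 ω
  refine pathProd_congr fun j hj => ?_
  simp [hext, hj]

/-- Both laws are the same infinite product of `stepLaw`. -/
theorem map_dropSeq (hmeas : ∀ k, Measurable (ξ k)) (hindep : iIndepFun ξ P)
    (hlaw : ∀ k, P.map (ξ k) = stepLaw q p) (m : ℕ) :
    P.map (fun ω => dropSeq m fun k => ξ k ω) = P.map fun ω k => ξ k ω := by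
  have h1 := hindep.map_fun_eq_infinitePi_map hmeas
  have h2 := (hindep.precomp (add_right_injective m)).map_fun_eq_infinitePi_map
    fun k => hmeas (m + k)
  rw [h1]
  change P.map (fun ω i => ξ (m + i) ω) = _
  rw [h2]
  simp only [hlaw]

theorem identDistrib_dropSeq (hmeas : ∀ k, Measurable (ξ k)) (hindep : iIndepFun ξ P)
    (hlaw : ∀ k, P.map (ξ k) = stepLaw q p) (m : ℕ) :
    IdentDistrib (fun ω => dropSeq m fun k => ξ k ω) (fun ω k => ξ k ω) P P where
  aemeasurable_fst := ((measurable_dropSeq m).comp (measurable_increments hmeas)).aemeasurable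
  aemeasurable_snd := (measurable_increments hmeas).aemeasurable
  map_eq := map_dropSeq hmeas hindep hlaw m

variable [IsProbabilityMeasure P]

theorem integrable_pathProd (hmeas : ∀ k, Measurable (ξ k))
    (hlaw : ∀ k, P.map (ξ k) = stepLaw q p) (n : ℕ) (f : Lamplighter q → ℝ) :
    Integrable (fun ω => f (pathProd (fun k => ξ k ω) n)) P := by
  obtain ⟨S, hS, h⟩ := ae_pathProd_mem hmeas hlaw n
  obtain ⟨C, hC⟩ := (hS.image fun z => ‖f z‖).bddAbove
  refine Integrable.of_bound ((Measurable.of_discrete (f := f)).comp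
    ((measurable_pathProd n).comp (measurable_increments hmeas))).aestronglyMeasurable C ?_
  filter_upwards [h] with ω hω
  exact hC ⟨_, hω, rfl⟩

/-- The operator `mean` computes expectations. -/
theorem integral_pathProd (hp0 : 0 ≤ p) (hp1 : p ≤ 1) (hmeas : ∀ k, Measurable (ξ k))
    (hindep : iIndepFun ξ P) (hlaw : ∀ k, P.map (ξ k) = stepLaw q p) (n : ℕ)
    (f : Lamplighter q → ℝ) :
    ∫ ω, f (pathProd (fun k => ξ k ω) n) ∂P = mean p n f := by
  induction n generalizing f with
  | zero => simp [pathProd, mean_zero]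
  | succ n ih =>
    have hZ : Measurable fun ω => pathProd (fun k => ξ k ω) n :=
      (measurable_pathProd n).comp (measurable_increments hmeas)
    have hind := (indepFun_iff_map_prod_eq_prod_map_map hZ.aemeasurable
      (hmeas n).aemeasurable).mp (indepFun_pathProd hmeas hindep n)
    have hmul : Measurable fun s : Lamplighter q × Lamplighter q => f (s.1 * s.2) :=
      Measurable.of_discrete
    have hpair := (hZ.prodMk (hmeas n)).aemeasurable (μ := P)
    have h1 : ∫ ω, f (pathProd (fun k => ξ k ω) (n + 1)) ∂P =
        ∫ s, f (s.1 * s.2) ∂(P.map fun ω => (pathProd (fun k => ξ k ω) n, ξ n ω)) :=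
      (integral_map hpair hmul.aestronglyMeasurable).symm
    have hint : Integrable (fun s : Lamplighter q × Lamplighter q => f (s.1 * s.2))
        (P.map fun ω => (pathProd (fun k => ξ k ω) n, ξ n ω)) :=
      (integrable_map_measure hmul.aestronglyMeasurable hpair).mpr
        (integrable_pathProd hmeas hlaw (n + 1) f)
    have := Measure.isProbabilityMeasure_map hZ.aemeasurable (μ := P)
    have := Measure.isProbabilityMeasure_map (hmeas n).aemeasurable (μ := P)
    rw [hind] at hint h1
    rw [h1, integral_prod _ hint, hlaw]
    simp only [integral_stepLaw hp0 hp1]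
    rw [integral_map hZ.aemeasurable Measurable.of_discrete.aestronglyMeasurable, ih, mean_succ]

end Increments

/-! ### Length functions and the almost sure rate of escape. -/

/-- A length function on the lamplighter group, bounded by `1` on the generators. -/
structure IsLengthFn (f : Lamplighter q → ℝ) : Prop where
  nonneg : ∀ z, 0 ≤ f z
  one : f 1 = 0
  mul_le : ∀ z w, f (z * w) ≤ f z + f w
  inv : ∀ z, f z⁻¹ = f z
  gens_le : ∀ s ∈ gens q, f s ≤ 1

theorem isLengthFn_tour : IsLengthFn fun z : Lamplighter q => (z.tour : ℝ) where
  nonneg z := Nat.cast_nonneg _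
  one := by simpa using isWordLength_tour.one
  mul_le z w := by exact_mod_cast isWordLength_tour.mul_le z w
  inv z := by rw [isWordLength_tour.inv]
  gens_le s hs := by exact_mod_cast isWordLength_tour.gen_le_one hs

theorem isLengthFn_len : IsLengthFn fun z : Lamplighter q => (len z.pos : ℝ) where
  nonneg z := Nat.cast_nonneg _
  one := by rw [Lamplighter.one_pos, len_one, Nat.cast_zero]
  mul_le z w := by exact_mod_cast len_mul_le z.pos w.pos
  inv z := by rw [inv_pos, len_inv]
  gens_le s hs := by
    rcases hs with rfl | ⟨i, rfl⟩
    · change (len (1 : Tree q) : ℝ) ≤ 1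
      rw [len_one]
      norm_num
    · change (len (letter i : Tree q) : ℝ) ≤ 1
      rw [len_letter]
      norm_num

namespace IsLengthFn

variable {f : Lamplighter q → ℝ} {x : ℕ → Lamplighter q}

theorem pathProd_le (hf : IsLengthFn f) (hx : ∀ k, x k ∈ gens q) (n : ℕ) :
    f (pathProd x n) ≤ n := by
  induction n with
  | zero => simp [pathProd, hf.one]
  | succ n ih =>
    rw [pathProd]
    push_cast
    exact (hf.mul_le _ _).trans (add_le_add ih (hf.gens_le _ (hx n)))

theorem pathProd_mul_le (hf : IsLengthFn f) (m j : ℕ) (x : ℕ → Lamplighter q) :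
    f (pathProd x (j * m)) ≤ ∑ i ∈ Finset.range j, f (pathProd (dropSeq (i * m) x) m) := by
  induction j with
  | zero => simp [pathProd, hf.one]
  | succ j ih =>
    rw [Finset.sum_range_succ, Nat.succ_mul, pathProd_add]
    exact (hf.mul_le _ _).trans (add_le_add ih le_rfl)

/-- If windows of length at most `M` with small displacement start at all times but the exceptional
ones, then the total displacement is small. -/
theorem pathProd_le_of_cover (hf : IsLengthFn f) {c : ℝ} (hc : 0 ≤ c) (M : ℕ)
    (bad : (ℕ → Lamplighter q) → ℝ) (hb : ∀ x, 0 ≤ bad x)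
    (hbad : ∀ x, (∀ n, 1 ≤ n → n ≤ M → c * n < f (pathProd x n)) → bad x = 1)
    (N : ℕ) {x : ℕ → Lamplighter q} (hx : ∀ k, x k ∈ gens q) :
    f (pathProd x N) ≤ c * N + ∑ j ∈ Finset.range N, bad (dropSeq j x) + M := by
  induction N using Nat.strong_induction_on generalizing x with
  | _ N ih =>
    have hsum : ∀ n, 0 ≤ ∑ j ∈ Finset.range n, bad (dropSeq j x) := fun n =>
      Finset.sum_nonneg fun j _ => hb _
    by_cases hN : N ≤ M
    · have h1 := hf.pathProd_le hx N
      have h2 : (N : ℝ) ≤ M := by exact_mod_cast hN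
      have h3 := mul_nonneg hc (Nat.cast_nonneg (α := ℝ) N)
      linarith [hsum N]
    have split : ∀ n, 1 ≤ n → n ≤ N → f (pathProd x N) ≤ f (pathProd x n) +
        (c * (N - n) + (∑ j ∈ Finset.range N, bad (dropSeq j x) -
          ∑ j ∈ Finset.range n, bad (dropSeq j x)) + M) := by
      intro n hn hnN
      have h1 := ih (N - n) (by omega) (x := dropSeq n x) (fun k => hx (n + k))
      have h2 : pathProd x N = pathProd x n * pathProd (dropSeq n x) (N - n) := by
        rw [← pathProd_add, Nat.add_sub_cancel' hnN]
      have h3 := Finset.sum_range_add (fun j => bad (dropSeq j x)) n (N - n)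
      rw [Nat.add_sub_cancel' hnN] at h3
      simp only [dropSeq_dropSeq, Nat.cast_sub hnN] at h1
      rw [h2, h3]
      have h4 := hf.mul_le (pathProd x n) (pathProd (dropSeq n x) (N - n))
      linarith
    -- At an exceptional time, advance by one increment, whose length at most `1` is paid for by
    -- `bad x = 1`. Otherwise jump over a window of slope at most `c`.
    by_cases hg : ∀ n, 1 ≤ n → n ≤ M → c * n < f (pathProd x n)
    · have h1 := split 1 le_rfl (by omega)
      have h2 : bad (dropSeq 0 x) = 1 := hbad _ (by
        have : dropSeq 0 x = x := by ext1 j; simp only [dropSeq, zero_add]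
        rwa [this])
      have h3 := hf.pathProd_le hx 1
      rw [Finset.sum_range_one, h2] at h1
      push_cast at h1 h3
      linarith
    · push Not at hg
      obtain ⟨n, hn1, hnM, hn⟩ := hg
      have h1 := split n hn1 (by omega)
      linarith [hsum n]

/-- The sequences along which the lower rate of escape is smaller than `c`. -/
def slow (f : Lamplighter q → ℝ) (c : ℝ) : Set (ℕ → Lamplighter q) :=
  {x | ∃ j : ℕ, ∃ᶠ n : ℕ in atTop, f (pathProd x n) ≤ (c - 1 / (j + 1)) * n}

theorem measurableSet_slow (f : Lamplighter q → ℝ) (c : ℝ) : MeasurableSet (slow f c) := by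
  have h : ∀ (n : ℕ) (a : ℝ), MeasurableSet {x : ℕ → Lamplighter q | f (pathProd x n) ≤ a} :=
    fun n a => ((Measurable.of_discrete (f := f)).comp (measurable_pathProd n)) measurableSet_Iic
  have h2 : slow f c = ⋃ j : ℕ, ⋂ N : ℕ, ⋃ n : ℕ, ⋃ _ : N ≤ n,
      {x | f (pathProd x n) ≤ (c - 1 / (j + 1)) * n} := by
    ext x
    simp only [slow, frequently_atTop, Set.mem_iUnion, Set.mem_iInter, Set.mem_ofPred_eq,
      exists_prop]
  rw [h2]
  exact MeasurableSet.iUnion fun j => MeasurableSet.iInter fun N => MeasurableSet.iUnion fun n =>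
    MeasurableSet.iUnion fun _ => h n _

theorem eventually_const_le_mul {C ε : ℝ} (hε : 0 < ε) : ∀ᶠ n : ℕ in atTop, C ≤ ε * n := by
  filter_upwards [eventually_ge_atTop ⌈C / ε⌉₊] with n hn
  have := (Nat.le_ceil (C / ε)).trans (by exact_mod_cast hn : ((⌈C / ε⌉₊ : ℕ) : ℝ) ≤ n)
  rwa [div_le_iff₀' hε] at this

theorem one_div_succ_lt (j : ℕ) : (1 : ℝ) / ((j + 1 : ℕ) + 1) < 1 / (j + 1) := by
  apply one_div_lt_one_div_of_lt
  · positivity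
  · push_cast
    linarith

/-- Dropping `k` entries changes the length by a bounded amount. This is absorbed, for large `n`, by
passing from `1/(j+1)` to the smaller slack `1/(j+2)`. -/
theorem dropSeq_mem_slow_iff (hf : IsLengthFn f) (c : ℝ) (k : ℕ) :
    dropSeq k x ∈ slow f c ↔ x ∈ slow f c := by
  constructor
  · rintro ⟨j, hj⟩
    refine ⟨j + 1, ?_⟩
    have hev := eventually_const_le_mul (C := f (pathProd x k) - (c - 1 / ((j + 1 : ℕ) + 1)) * k)
      (sub_pos.mpr (one_div_succ_lt j))
    refine ((tendsto_add_atTop_nat k).congr fun n => add_comm n k).frequently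
      ((hj.and_eventually hev).mono ?_)
    rintro n ⟨h1, h2⟩
    rw [pathProd_add]
    push_cast at h2 ⊢
    linarith [hf.mul_le (pathProd x k) (pathProd (dropSeq k x) n)]
  · rintro ⟨j, hj⟩
    refine ⟨j + 1, ?_⟩
    have hj' : ∃ᶠ n : ℕ in atTop, f (pathProd x (n + k)) ≤ (c - 1 / (j + 1)) * (n + k : ℕ) := by
      rw [← map_add_atTop_eq_nat k] at hj
      exact hj
    have hev := eventually_const_le_mul (C := f (pathProd x k) + (c - 1 / (j + 1)) * k)
      (sub_pos.mpr (one_div_succ_lt j))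
    refine (hj'.and_eventually hev).mono ?_
    rintro n ⟨h1, h2⟩
    have h3 := hf.mul_le (pathProd x k)⁻¹ (pathProd x (k + n))
    rw [pathProd_add, inv_mul_cancel_left, hf.inv, ← pathProd_add, add_comm k n] at h3
    push_cast at h1 h2 ⊢
    linarith

section Probability

variable {Ω : Type*} [mΩ : MeasurableSpace Ω] {P : Measure Ω}
  {ξ : ℕ → Ω → Lamplighter q} {p : ℝ}

/-- By `dropSeq_mem_slow_iff` the event is in the tail σ-algebra, so Kolmogorov's zero-one law
applies. -/
theorem measure_slow_zero_or_one (hf : IsLengthFn f) (hmeas : ∀ k, Measurable (ξ k))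
    (hindep : iIndepFun ξ P) (c : ℝ) :
    P {ω | (fun k => ξ k ω) ∈ slow f c} = 0 ∨ P {ω | (fun k => ξ k ω) ∈ slow f c} = 1 := by
  have hind : iIndep (fun k => MeasurableSpace.comap (ξ k) ⊤) P := hindep.iIndep
  refine measure_zero_or_one_of_measurableSet_limsup_atTop (fun k => (hmeas k).comap_le) hind ?_
  rw [limsup_eq_iInf_iSup_of_nat, MeasurableSpace.measurableSet_iInf]
  intro k
  have h1 : {ω | (fun k => ξ k ω) ∈ slow f c} =
      (fun ω => dropSeq k fun k => ξ k ω) ⁻¹' slow f c := by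
    ext ω
    exact (hf.dropSeq_mem_slow_iff c k).symm
  rw [h1]
  have h2 : Measurable[⨆ i ≥ k, MeasurableSpace.comap (ξ i) ⊤]
      (fun ω => dropSeq k fun k => ξ k ω) := by
    refine @measurable_pi_lambda _ _ _ (⨆ i ≥ k, MeasurableSpace.comap (ξ i) ⊤) _ _ fun j => ?_
    refine Measurable.of_comap_le ?_
    exact le_iSup₂_of_le (k + j) (Nat.le_add_right k j) le_rfl
  exact h2 (measurableSet_slow f c)

theorem indepFun_blocks (hmeas : ∀ k, Measurable (ξ k)) (hindep : iIndepFun ξ P)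
    (f : Lamplighter q → ℝ) (m : ℕ) {i j : ℕ} (hij : i ≠ j) :
    IndepFun (fun ω => f (pathProd (dropSeq (i * m) fun k => ξ k ω) m))
      (fun ω => f (pathProd (dropSeq (j * m) fun k => ξ k ω) m)) P := by
  set S : ℕ → Finset ℕ := fun i => Finset.Ico (i * m) (i * m + m) with hS
  have hdisj : ∀ {i j : ℕ}, i < j → Disjoint (S i) (S j) := by
    intro i j hij
    have : i * m + m ≤ j * m := by nlinarith
    exact Finset.disjoint_left.mpr fun k h1 h2 => by
      simp only [hS, Finset.mem_Ico] at h1 h2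
      omega
  have hd : Disjoint (S i) (S j) := by
    rcases lt_or_gt_of_ne hij with h | h
    · exact hdisj h
    · exact (hdisj h).symm
  have hmeasS : ∀ i, Measurable fun y : S i → Lamplighter q =>
      (fun k : ℕ => if h : i * m + k ∈ S i then y ⟨i * m + k, h⟩ else 1) := by
    intro i
    refine measurable_pi_lambda _ fun k => ?_
    by_cases h : i * m + k ∈ S i
    · simp only [dif_pos h]
      exact measurable_pi_apply _
    · simp only [dif_neg h]
      exact measurable_const
  have h := (hindep.indepFun_finset (S i) (S j) hd hmeas).comp
    ((Measurable.of_discrete (f := f)).comp ((measurable_pathProd m).comp (hmeasS i)))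
    ((Measurable.of_discrete (f := f)).comp ((measurable_pathProd m).comp (hmeasS j)))
  have heq : ∀ i, (fun ω => f (pathProd (dropSeq (i * m) fun k => ξ k ω) m)) =
      (f ∘ (fun x => pathProd x m) ∘ fun y : S i → Lamplighter q =>
        (fun k : ℕ => if h : i * m + k ∈ S i then y ⟨i * m + k, h⟩ else 1)) ∘
        fun ω (k : S i) => ξ k ω := by
    intro i
    ext1 ω
    simp only [Function.comp_apply]
    refine congrArg f (pathProd_congr fun k hk => ?_)
    rw [dif_pos (by simp only [hS, Finset.mem_Ico]; omega)]
    rfl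
  rw [heq i, heq j]
  exact h

variable [IsProbabilityMeasure P]

/-- The lower rate of escape is at least the limit of the expectations. -/
theorem measure_slow_eq_zero (hf : IsLengthFn f) (hp0 : 0 ≤ p) (hp1 : p ≤ 1)
    (hmeas : ∀ k, Measurable (ξ k)) (hindep : iIndepFun ξ P)
    (hlaw : ∀ k, P.map (ξ k) = stepLaw q p) {ℓ c : ℝ}
    (hℓ : Tendsto (fun n : ℕ => mean p n f / n) atTop (𝓝 ℓ)) (hc : c < ℓ) :
    P {ω | (fun k => ξ k ω) ∈ slow f c} = 0 := by
  refine (hf.measure_slow_zero_or_one hmeas hindep c).resolve_right fun h1 => ?_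
  have hX := measurable_increments hmeas
  have hae : ∀ᵐ ω ∂P, (fun k => ξ k ω) ∈ slow f c :=
    (mem_ae_iff_prob_eq_one (hX (measurableSet_slow f c))).mpr h1
  have hslow : ∀ x : ℕ → Lamplighter q, x ∈ slow f c →
      ∃ n : ℕ, 1 ≤ n ∧ f (pathProd x n) ≤ c * n := by
    rintro x ⟨j, hj⟩
    obtain ⟨n, hn, hn1⟩ := (hj.and_eventually (eventually_ge_atTop 1)).exists
    refine ⟨n, hn1, hn.trans (mul_le_mul_of_nonneg_right ?_ (Nat.cast_nonneg n))⟩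
    have : (0 : ℝ) < 1 / (j + 1) := by positivity
    linarith
  have hc0 : 0 ≤ c := by
    obtain ⟨ω, hω⟩ := hae.exists
    obtain ⟨n, hn1, hn⟩ := hslow _ hω
    have h2 : (0 : ℝ) < n := by exact_mod_cast hn1
    exact nonneg_of_mul_nonneg_left ((hf.nonneg _).trans hn) h2
  set bad : ℕ → Set (ℕ → Lamplighter q) := fun M =>
    {x | ∀ n : ℕ, 1 ≤ n → n ≤ M → c * n < f (pathProd x n)} with hbad
  have hbm : ∀ M, MeasurableSet (bad M) := by
    intro M
    have : bad M = ⋂ n : ℕ, ⋂ _ : 1 ≤ n, ⋂ _ : n ≤ M, {x | c * n < f (pathProd x n)} := by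
      ext x
      simp only [hbad, Set.mem_iInter, Set.mem_ofPred_eq]
    rw [this]
    exact MeasurableSet.iInter fun n => MeasurableSet.iInter fun _ => MeasurableSet.iInter fun _ =>
      ((Measurable.of_discrete (f := f)).comp (measurable_pathProd n)) measurableSet_Ioi
  set β : ℕ → ℝ := fun M => P.real ((fun ω k => ξ k ω) ⁻¹' bad M) with hβ
  -- Every slow sequence has some window of slope at most `c`, so almost no sequence is exceptional
  -- for all `M`.
  have hβ0 : Tendsto β atTop (𝓝 0) := by
    have h2 : P (⋂ M, (fun ω k => ξ k ω) ⁻¹' bad M) = 0 := by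
      refine measure_mono_null ?_ hae
      intro ω hω hs
      obtain ⟨n, hn1, hn⟩ := hslow _ hs
      exact absurd (Set.mem_iInter.mp hω n n hn1 le_rfl) (not_lt.mpr hn)
    have h3 := tendsto_measure_iInter_atTop (μ := P)
      (s := fun M => (fun ω k => ξ k ω) ⁻¹' bad M)
      (fun M => (hX (hbm M)).nullMeasurableSet)
      (fun M N hMN ω hω n hn1 hn => hω n hn1 (hn.trans hMN)) ⟨0, measure_ne_top _ _⟩
    rw [h2] at h3
    exact (ENNReal.tendsto_toReal ENNReal.zero_ne_top).comp h3
  -- Expectation of the covering bound; by stationarity each of the `N` starting times is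
  -- exceptional with probability `β M`.
  have hbound : ∀ M N : ℕ, mean p N f ≤ c * N + N * β M + M := by
    intro M N
    have hint : ∀ j, Integrable (fun ω => (bad M).indicator (fun _ => (1 : ℝ))
        (dropSeq j fun k => ξ k ω)) P := fun j => by
      change Integrable (((fun ω => dropSeq j fun k => ξ k ω) ⁻¹' bad M).indicator
        fun _ => (1 : ℝ)) P
      exact (integrable_const 1).indicator (((measurable_dropSeq j).comp hX) (hbm M))
    have hsum : Integrable (fun ω => ∑ j ∈ Finset.range N, (bad M).indicator (fun _ => (1 : ℝ))
        (dropSeq j fun k => ξ k ω)) P := integrable_finsetSum _ fun j _ => hint j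
    have hval : ∀ j, ∫ ω, (bad M).indicator (fun _ => (1 : ℝ)) (dropSeq j fun k => ξ k ω) ∂P =
        β M := by
      intro j
      have h2 := ((identDistrib_dropSeq hmeas hindep hlaw j).comp
        ((measurable_const (a := (1 : ℝ))).indicator (hbm M))).integral_eq
      refine h2.trans ?_
      exact integral_indicator_one (hX (hbm M))
    rw [← integral_pathProd hp0 hp1 hmeas hindep hlaw N f]
    have h4 : ∫ ω, (∑ j ∈ Finset.range N, (bad M).indicator (fun _ => (1 : ℝ))
        (dropSeq j fun k => ξ k ω) + (c * N + M)) ∂P = c * N + N * β M + M := by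
      rw [integral_add hsum (integrable_const _), integral_finsetSum _ fun j _ => hint j]
      simp only [hval, Finset.sum_const, Finset.card_range, nsmul_eq_mul, integral_const,
        probReal_univ, one_smul]
      ring
    rw [← h4]
    refine integral_mono_ae (integrable_pathProd hmeas hlaw N f)
      (hsum.add (integrable_const _)) ?_
    filter_upwards [ae_mem_gens hmeas hlaw] with ω hω
    have h5 := hf.pathProd_le_of_cover hc0 M ((bad M).indicator fun _ => 1)
      (fun x => Set.indicator_nonneg (fun _ _ => zero_le_one) x)
      (fun x hx => Set.indicator_of_mem (show x ∈ bad M from hx) _) N hω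
    refine h5.trans_eq ?_
    ring
  -- Dividing by `N → ∞` and then letting `M → ∞` gives `ℓ ≤ c`, the contradiction.
  have hle : ∀ M : ℕ, ℓ ≤ c + β M := by
    intro M
    have h2 : Tendsto (fun N : ℕ => c + β M + (M : ℝ) / N) atTop (𝓝 (c + β M + 0)) :=
      (tendsto_const_div_atTop_nhds_zero_nat (M : ℝ)).const_add _
    rw [add_zero] at h2
    refine le_of_tendsto_of_tendsto hℓ h2 ?_
    filter_upwards [eventually_gt_atTop 0] with N hN
    have hN' : (0 : ℝ) < N := by exact_mod_cast hN
    rw [div_le_iff₀ hN']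
    refine (hbound M N).trans_eq ?_
    field_simp
  have hfin := ge_of_tendsto' (hβ0.const_add c) hle
  linarith

/-- The upper rate of escape is bounded by averages over blocks. -/
theorem ae_eventually_pathProd_lt (hf : IsLengthFn f) (hp0 : 0 ≤ p) (hp1 : p ≤ 1)
    (hmeas : ∀ k, Measurable (ξ k)) (hindep : iIndepFun ξ P)
    (hlaw : ∀ k, P.map (ξ k) = stepLaw q p) {m : ℕ} (hm : 0 < m) :
    ∀ᵐ ω ∂P, ∀ b, mean p m f / m < b →
      ∀ᶠ n : ℕ in atTop, f (pathProd (fun k => ξ k ω) n) / n < b := by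
  have hfm : Measurable fun x : ℕ → Lamplighter q => f (pathProd x m) :=
    (Measurable.of_discrete (f := f)).comp (measurable_pathProd m)
  have hid : ∀ i, IdentDistrib (fun ω => f (pathProd (dropSeq (i * m) fun k => ξ k ω) m))
      (fun ω => f (pathProd (fun k => ξ k ω) m)) P P := fun i =>
    (identDistrib_dropSeq hmeas hindep hlaw (i * m)).comp hfm
  -- Subadditivity bounds the length by the sum over disjoint blocks of `m` increments, which are
  -- i.i.d.; the incomplete last block costs at most `m`.
  have hslln := strong_law_ae_real (μ := P)
    (fun i ω => f (pathProd (dropSeq (i * m) fun k => ξ k ω) m))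
    ((hid 0).integrable_iff.mpr (integrable_pathProd hmeas hlaw m f))
    (fun i j hij => indepFun_blocks hmeas hindep f m hij)
    (fun i => (hid i).trans (hid 0).symm)
  rw [(hid 0).integral_eq, integral_pathProd hp0 hp1 hmeas hindep hlaw] at hslln
  filter_upwards [hslln, ae_mem_gens hmeas hlaw] with ω h1 h2 b hb
  have hm' : (0 : ℝ) < m := by exact_mod_cast hm
  set x : ℕ → Lamplighter q := fun k => ξ k ω with hx
  set A : ℕ → ℝ := fun j => (∑ i ∈ Finset.range j, f (pathProd (dropSeq (i * m) x) m)) / j with hA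
  have hA0 : ∀ j, 0 ≤ A j := fun j =>
    div_nonneg (Finset.sum_nonneg fun i _ => hf.nonneg _) (Nat.cast_nonneg j)
  have hdiv : Tendsto (fun n : ℕ => n / m) atTop atTop := Nat.tendsto_div_const_atTop hm.ne'
  have h3 : Tendsto (fun n : ℕ => A (n / m) / m + (m : ℝ) / n) atTop
      (𝓝 (mean p m f / m + 0)) :=
    ((h1.comp hdiv).div_const _).add (tendsto_const_div_atTop_nhds_zero_nat (m : ℝ))
  rw [add_zero] at h3
  filter_upwards [h3.eventually_lt_const hb, eventually_gt_atTop 0,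
    hdiv.eventually_gt_atTop 0] with n h4 hn hnm
  refine lt_of_le_of_lt ?_ h4
  have hn' : (0 : ℝ) < n := by exact_mod_cast hn
  have hnm' : (0 : ℝ) < (n / m : ℕ) := by exact_mod_cast hnm
  have h5 : f (pathProd x n) ≤ A (n / m) * (n / m : ℕ) + m := by
    have h6 : pathProd x n =
        pathProd x (n / m * m) * pathProd (dropSeq (n / m * m) x) (n % m) := by
      rw [← pathProd_add, Nat.div_add_mod']
    have h7 := hf.pathProd_le (x := dropSeq (n / m * m) x) (fun k => h2 _) (n % m)
    have h8 : ((n % m : ℕ) : ℝ) ≤ m := by exact_mod_cast (Nat.mod_lt n hm).le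
    have h9 := hf.pathProd_mul_le m (n / m) x
    have h10 : A (n / m) * (n / m : ℕ) =
        ∑ i ∈ Finset.range (n / m), f (pathProd (dropSeq (i * m) x) m) :=
      div_mul_cancel₀ _ hnm'.ne'
    rw [h6, h10]
    exact (hf.mul_le _ _).trans (add_le_add h9 (h7.trans h8))
  have h6 : ((n / m : ℕ) : ℝ) ≤ n / m := Nat.cast_div_le
  rw [div_le_iff₀ hn']
  calc f (pathProd x n) ≤ A (n / m) * (n / m) + m :=
        h5.trans (by linarith [mul_le_mul_of_nonneg_left h6 (hA0 (n / m))])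
    _ = (A (n / m) / m + m / n) * n := by field_simp

/-- The rate of escape exists almost surely, and is the limit of the expectations. -/
theorem ae_tendsto_pathProd_div (hf : IsLengthFn f) (hp0 : 0 ≤ p) (hp1 : p ≤ 1)
    (hmeas : ∀ k, Measurable (ξ k)) (hindep : iIndepFun ξ P)
    (hlaw : ∀ k, P.map (ξ k) = stepLaw q p) {ℓ : ℝ}
    (hℓ : Tendsto (fun n : ℕ => mean p n f / n) atTop (𝓝 ℓ)) :
    ∀ᵐ ω ∂P, Tendsto (fun n : ℕ => f (pathProd (fun k => ξ k ω) n) / n) atTop (𝓝 ℓ) := by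
  have hlow : ∀ᵐ ω ∂P, ∀ i : ℕ, (fun k => ξ k ω) ∉ slow f (ℓ - 1 / (i + 1)) := by
    refine ae_all_iff.mpr fun i => ?_
    have h : ℓ - 1 / (i + 1 : ℝ) < ℓ := by
      have : (0 : ℝ) < 1 / (i + 1) := by positivity
      linarith
    have := hf.measure_slow_eq_zero hp0 hp1 hmeas hindep hlaw hℓ h
    rw [ae_iff]
    simpa only [not_not] using this
  have hup : ∀ᵐ ω ∂P, ∀ m : ℕ, 0 < m → ∀ b, mean p m f / m < b →
      ∀ᶠ n : ℕ in atTop, f (pathProd (fun k => ξ k ω) n) / n < b := by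
    refine ae_all_iff.mpr fun m => ?_
    rcases Nat.eq_zero_or_pos m with rfl | hm
    · exact Eventually.of_forall fun ω h => absurd h (lt_irrefl 0)
    · filter_upwards [hf.ae_eventually_pathProd_lt hp0 hp1 hmeas hindep hlaw hm] with ω h _ using h
  filter_upwards [hlow, hup] with ω h1 h2
  refine tendsto_order.mpr ⟨fun a ha => ?_, fun b hb => ?_⟩
  -- Half of the gap is needed because `1/(i+1)` is lost twice: in the level `ℓ - 1/(i+1)`, and as
  -- the slack in `slow`.
  · obtain ⟨i, hi⟩ := exists_nat_one_div_lt (half_pos (sub_pos.mpr ha))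
    have h3 := h1 i
    simp only [slow, Set.mem_ofPred_eq, not_exists, not_frequently, not_le] at h3
    filter_upwards [h3 i, eventually_gt_atTop 0] with n hn hn0
    have hn' : (0 : ℝ) < n := by exact_mod_cast hn0
    rw [lt_div_iff₀ hn']
    refine lt_of_le_of_lt (mul_le_mul_of_nonneg_right ?_ hn'.le) hn
    linarith
  · obtain ⟨m, hm, hm0⟩ := ((hℓ.eventually_lt_const hb).and (eventually_gt_atTop 0)).exists
    exact h2 m hm0 b hm

end Probability

end IsLengthFn

end LamplighterTree

/-- For `q ≥ 3`, `p ∈ (0,1)` and i.i.d. increments `ξ` with law `stepLaw q p`, the rate of escape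
`ℓ` exists almost surely as a constant, `ℓ_low ≤ ℓ ≤ ℓ_up` (with `Ĝ` in closed form, and also with
the sharper value `1 / (1 - Û)`), and `ℓ` exceeds the speed of the projection onto the tree. -/
theorem mainTheorem2 (q : ℕ) (hq : 3 ≤ q) (p : ℝ) (hp0 : 0 < p) (hp1 : p < 1)
    {Ω : Type*} [MeasurableSpace Ω] (P : MeasureTheory.Measure Ω)
    [MeasureTheory.IsProbabilityMeasure P]
    (ξ : ℕ → Ω → LamplighterTree.Lamplighter q)
    (hmeas : ∀ k, Measurable (ξ k))
    (hindep : ProbabilityTheory.iIndepFun ξ P)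
    (hlaw : ∀ k, MeasureTheory.Measure.map (ξ k) P =
      LamplighterTree.Lamplighter.stepLaw q p) :
    ∃ ℓ : ℝ,
      (∀ᵐ ω ∂P, Filter.Tendsto
        (fun n : ℕ => ((LamplighterTree.Lamplighter.walk ξ n ω).length : ℝ) / n)
        Filter.atTop (nhds ℓ)) ∧
      (∀ᵐ ω ∂P, Filter.Tendsto
        (fun n : ℕ =>
          (LamplighterTree.treeDist (LamplighterTree.Lamplighter.walk ξ n ω).pos : ℝ) / n)
        Filter.atTop (nhds (LamplighterTree.treeSpeed q p))) ∧
      LamplighterTree.ellLow q p ≤ ℓ ∧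
      ℓ ≤ LamplighterTree.ellOfNu q p
        (LamplighterTree.nuHat q p (LamplighterTree.greenHat q p)) ∧
      ℓ ≤ LamplighterTree.ellOfNu q p
        (LamplighterTree.nuHat q p (LamplighterTree.greenHatSharp q p)) ∧
      LamplighterTree.treeSpeed q p < ℓ := by
  have hq0 : q ≠ 0 := by omega
  have hT := LamplighterTree.isLengthFn_tour (q := q)
  have hD := LamplighterTree.isLengthFn_len (q := q)
  obtain ⟨ℓ, hℓ⟩ := LamplighterTree.exists_tendsto_mean_div hq0 hp0.le hp1.le hT.nonneg hT.mul_le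
  obtain ⟨v, hv⟩ := LamplighterTree.exists_tendsto_mean_div hq0 hp0.le hp1.le hD.nonneg hD.mul_le
  have hsharp := LamplighterTree.le_ellOfNu_sharp_of_tendsto hq hp0 hp1 hℓ
  have hlow := LamplighterTree.ellLow_le_of_tendsto hq hp0 hp1 hℓ
  refine ⟨ℓ, ?_, ?_, hlow, hsharp.trans (LamplighterTree.ellOfNu_sharp_le hq hp0 hp1), hsharp,
    (LamplighterTree.treeSpeed_lt_ellLow hq hp0 hp1).trans_le hlow⟩
  · simpa only [LamplighterTree.Lamplighter.length_eq_tour, LamplighterTree.walk_eq_pathProd] using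
      hT.ae_tendsto_pathProd_div hp0.le hp1.le hmeas hindep hlaw hℓ
  · rw [← LamplighterTree.eq_treeSpeed_of_tendsto hq hp0 hp1 hv]
    simpa only [LamplighterTree.treeDist_eq_len, LamplighterTree.walk_eq_pathProd] using
      hD.ae_tendsto_pathProd_div hp0.le hp1.le hmeas hindep hlaw hv
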